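/- Let $H$ be a group, let $B$ be a normal subgroup of $H$ of prime index $p$, and let $\theta : H \to B$ be an isomorphism. Let $G = H*_\theta$ be the HNN extension of $H$ relative to $\theta$, that is, the group generated by $H$ and a letter $t$ subject to the relations of $H$ and $tht^{-1} = \theta(h)$ for all $h \in H$, and assume that $G$ is finitely generated. For a finite generating set $S$ of $G$ let $\ell_S(g)$ be the minimal length of a word in $S \cup S^{-1}$ representing $g \in G$, let $\omega(G,S) = \lim_{n\to\infty} \#\{g \in G : \ell_S(g) \le n\}^{1/n}$ (this limit exists), and let $\Omega(G) = \inf_S \omega(G,S)$, the infimum being over all finite generating sets $S$ of $G$. For an integer $k \ge 1$ let $\omega_k$ be the unique positive root of $$T_k(x) = x^{k+1} - x^k - 2x^{k-1} - \dots - 2x - 2.$$ Then $$\Omega(G) \ge \frac{1+\sqrt5}{2} \quad \text{if } p = 2, \qquad \Omega(G) \ge \omega_k \quad \text{if } p = 2k+1.$$ -/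

import Mathlib

open Filter Topology

noncomputable section

namespace GroupGrowth

variable {G : Type*} [Group G]

/-- `IsWord S l` says that `l` is a word in the alphabet `S ∪ S⁻¹`. -/
def IsWord (S : Set G) (l : List G) : Prop :=
  ∀ x ∈ l, x ∈ S ∨ x⁻¹ ∈ S

/-- The length of `g` with respect to a generating set `S`: the minimal length of a word in
`S ∪ S⁻¹` whose product is `g`. -/
def wordLength (S : Set G) (g : G) : ℕ :=
  sInf {n : ℕ | ∃ l : List G, IsWord S l ∧ l.prod = g ∧ l.length = n}

/-- The ball of radius `n` around the identity for the word length of `S`. -/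
def ball (S : Set G) (n : ℕ) : Set G :=
  {g : G | wordLength S g ≤ n}

/-- The growth function: the number of elements of the ball of radius `n`. -/
def growthFunction (S : Set G) (n : ℕ) : ℕ :=
  (ball S n).ncard

/-- The exponential growth rate `lim F(n)^(1/n)` of `G` with respect to a finite generating
set `S`. The limit exists, see `tendsto_growthRate`. -/
def growthRate (S : Set G) : ℝ :=
  limUnder atTop fun n : ℕ => (growthFunction S n : ℝ) ^ (1 / (n : ℝ))

variable (G) in
/-- The minimal exponential growth rate: the infimum of the exponential growth rates over all
finite generating sets of the finitely generated group `G`. -/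
def minGrowthRate : ℝ :=
  sInf {r : ℝ | ∃ S : Set G, S.Finite ∧ Subgroup.closure S = ⊤ ∧ growthRate S = r}

theorem exists_word {S : Set G} (hS : Subgroup.closure S = ⊤) (g : G) :
    ∃ l : List G, IsWord S l ∧ l.prod = g := by
  have hg : g ∈ Subgroup.closure S := by rw [hS]; trivial
  rw [← Subgroup.mem_toSubmonoid, Subgroup.closure_toSubmonoid] at hg
  obtain ⟨l, hl, h⟩ := Submonoid.exists_list_of_mem_closure hg
  exact ⟨l, fun x hx => by simpa using hl x hx, h⟩

theorem exists_word_length_eq {S : Set G} (hS : Subgroup.closure S = ⊤) (g : G) :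
    ∃ l : List G, IsWord S l ∧ l.prod = g ∧ l.length = wordLength S g := by
  have hne : {n : ℕ | ∃ l : List G, IsWord S l ∧ l.prod = g ∧ l.length = n}.Nonempty := by
    obtain ⟨l, hl, hg⟩ := exists_word hS g
    exact ⟨l.length, l, hl, hg, rfl⟩
  exact Nat.sInf_mem hne

theorem mem_ball_iff {S : Set G} (hS : Subgroup.closure S = ⊤) (n : ℕ) (g : G) :
    g ∈ ball S n ↔ ∃ l : List G, IsWord S l ∧ l.prod = g ∧ l.length ≤ n := by
  constructor
  · intro hg
    obtain ⟨l, hl, h, hn⟩ := exists_word_length_eq hS g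
    exact ⟨l, hl, h, hn.trans_le hg⟩
  · rintro ⟨l, hl, h, hn⟩
    exact (Nat.sInf_le ⟨l, hl, h, rfl⟩ : wordLength S g ≤ l.length).trans hn

theorem finite_ball {S : Set G} (hfin : S.Finite) (hS : Subgroup.closure S = ⊤) (n : ℕ) :
    (ball S n).Finite := by
  have hT : {x : G | x ∈ S ∨ x⁻¹ ∈ S}.Finite := by
    have : {x : G | x ∈ S ∨ x⁻¹ ∈ S} = S ∪ (fun x : G => x⁻¹) '' S := by
      ext x
      simp
    rw [this]
    exact hfin.union (hfin.image _)
  have : Finite {x : G // x ∈ S ∨ x⁻¹ ∈ S} := hT.to_subtype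
  refine ((List.finite_length_le {x : G // x ∈ S ∨ x⁻¹ ∈ S} n).image
    fun l => (l.map Subtype.val).prod).subset ?_
  intro g hg
  obtain ⟨l, hl, h, hn⟩ := (mem_ball_iff hS n g).1 hg
  refine ⟨l.attach.map fun x => ⟨x.1, hl x.1 x.2⟩, by simpa using hn, ?_⟩
  simp [List.map_map, Function.comp_def, h]

theorem one_le_growthFunction {S : Set G} (hfin : S.Finite) (hS : Subgroup.closure S = ⊤)
    (n : ℕ) : 1 ≤ growthFunction S n := by
  have h1 : (1 : G) ∈ ball S n :=
    (mem_ball_iff hS n 1).2 ⟨[], by simp [IsWord], by simp, by simp⟩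
  exact (Set.ncard_pos (finite_ball hfin hS n)).2 ⟨1, h1⟩

theorem growthFunction_add_le {S : Set G} (hfin : S.Finite) (hS : Subgroup.closure S = ⊤)
    (m n : ℕ) : growthFunction S (m + n) ≤ growthFunction S m * growthFunction S n := by
  have hsub : ball S (m + n) ⊆ (fun q : G × G => q.1 * q.2) '' (ball S m ×ˢ ball S n) := by
    intro g hg
    obtain ⟨l, hl, h, hn⟩ := (mem_ball_iff hS _ g).1 hg
    refine ⟨((l.take m).prod, (l.drop m).prod), ⟨?_, ?_⟩, ?_⟩
    · exact (mem_ball_iff hS _ _).2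
        ⟨_, fun x hx => hl x (List.mem_of_mem_take hx), rfl, by simp⟩
    · exact (mem_ball_iff hS _ _).2
        ⟨_, fun x hx => hl x (List.mem_of_mem_drop hx), rfl, by simp; omega⟩
    · simp [h]
  have hf := (finite_ball hfin hS m).prod (finite_ball hfin hS n)
  calc (ball S (m + n)).ncard
      ≤ ((fun q : G × G => q.1 * q.2) '' (ball S m ×ˢ ball S n)).ncard :=
        Set.ncard_le_ncard hsub (hf.image _)
    _ ≤ (ball S m ×ˢ ball S n).ncard := Set.ncard_image_le hf
    _ = _ := Set.ncard_prod

/-- The limit in the definition of the exponential growth rate exists. -/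
theorem tendsto_growthRate {S : Set G} (hfin : S.Finite) (hS : Subgroup.closure S = ⊤) :
    Tendsto (fun n : ℕ => (growthFunction S n : ℝ) ^ (1 / (n : ℝ))) atTop
      (𝓝 (growthRate S)) := by
  have hpos : ∀ n, (1 : ℝ) ≤ growthFunction S n := fun n => by
    exact_mod_cast one_le_growthFunction hfin hS n
  have hsub : Subadditive fun n => Real.log (growthFunction S n) := by
    intro m n
    have h0 := hpos m
    have h1 := hpos n
    have h2 := hpos (m + n)
    rw [← Real.log_mul (by positivity) (by positivity)]
    refine Real.log_le_log (by positivity) ?_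
    exact_mod_cast growthFunction_add_le hfin hS m n
  have hbdd : BddBelow (Set.range fun n : ℕ => Real.log (growthFunction S n) / n) := by
    refine ⟨0, ?_⟩
    rintro _ ⟨n, rfl⟩
    exact div_nonneg (Real.log_nonneg (hpos n)) (Nat.cast_nonneg n)
  have hlim := (Real.continuous_exp.tendsto _).comp (hsub.tendsto_lim hbdd)
  have heq : (fun n : ℕ => (growthFunction S n : ℝ) ^ (1 / (n : ℝ))) =
      Real.exp ∘ fun n : ℕ => Real.log (growthFunction S n) / n := by
    funext n
    have h0 := hpos n
    rw [Real.rpow_def_of_pos (by linarith), Function.comp_apply, mul_one_div]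
  exact tendsto_nhds_limUnder ⟨_, by rw [heq]; exact hlim⟩

open Polynomial in
/-- The polynomial `T_k(x) = x^(k+1) - x^k - 2 x^(k-1) - ... - 2 x - 2`. -/
def rootPoly (k : ℕ) : ℝ[X] :=
  X ^ (k + 1) - X ^ k - ∑ i ∈ Finset.range k, 2 * X ^ i

theorem eval_rootPoly (k : ℕ) (x : ℝ) :
    (rootPoly k).eval x = x ^ (k + 1) - x ^ k - ∑ i ∈ Finset.range k, 2 * x ^ i := by
  simp [rootPoly, Polynomial.eval_finsetSum]

theorem existsUnique_pos_root (k : ℕ) : ∃! x : ℝ, 0 < x ∧ (rootPoly k).IsRoot x := by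
  have hlt : ∀ x y : ℝ, 0 < x → x < y → (rootPoly k).eval x = 0 →
      (rootPoly k).eval y = 0 → False := by
    intro x y hx hxy h1 h2
    have hy : 0 < y := hx.trans hxy
    rw [eval_rootPoly] at h1 h2
    have key : ∀ i, i < k + 1 → y ^ i * x ^ (k + 1) < x ^ i * y ^ (k + 1) := by
      intro i hi
      obtain ⟨j, hj⟩ := Nat.exists_eq_add_of_lt hi
      have hp : x ^ (j + 1) < y ^ (j + 1) := pow_lt_pow_left₀ hxy hx.le (by omega)
      have e : k + 1 = i + (j + 1) := by omega
      rw [e, pow_add x i (j + 1), pow_add y i (j + 1)]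
      have : 0 < x ^ i * y ^ i := by positivity
      nlinarith [mul_lt_mul_of_pos_left hp this]
    have hs : (∑ i ∈ Finset.range k, 2 * y ^ i) * x ^ (k + 1) ≤
        (∑ i ∈ Finset.range k, 2 * x ^ i) * y ^ (k + 1) := by
      rw [Finset.sum_mul, Finset.sum_mul]
      refine Finset.sum_le_sum fun i hi => ?_
      have := key i (by have := Finset.mem_range.1 hi; omega)
      nlinarith
    have hk := key k (by omega)
    have e1 : x ^ (k + 1) = x ^ k + ∑ i ∈ Finset.range k, 2 * x ^ i := by linarith
    have e2 : y ^ (k + 1) = y ^ k + ∑ i ∈ Finset.range k, 2 * y ^ i := by linarith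
    have c1 : x ^ (k + 1) * y ^ (k + 1) =
        (x ^ k + ∑ i ∈ Finset.range k, 2 * x ^ i) * y ^ (k + 1) := by rw [← e1]
    have c2 : y ^ (k + 1) * x ^ (k + 1) =
        (y ^ k + ∑ i ∈ Finset.range k, 2 * y ^ i) * x ^ (k + 1) := by rw [← e2]
    nlinarith
  have hex : ∃ x : ℝ, 0 < x ∧ (rootPoly k).eval x = 0 := by
    have h1 : (rootPoly k).eval 1 ≤ 0 := by
      rw [eval_rootPoly]
      simp
    have h3 : 0 ≤ (rootPoly k).eval 3 := by
      rw [eval_rootPoly, ← Finset.mul_sum, geom_sum_eq (by norm_num)]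
      have : (0 : ℝ) < 3 ^ k := by positivity
      rw [pow_succ]
      linarith
    obtain ⟨x, hx, hx0⟩ := intermediate_value_Icc (by norm_num : (1 : ℝ) ≤ 3)
      (rootPoly k).continuous.continuousOn ⟨h1, h3⟩
    exact ⟨x, by linarith [hx.1], hx0⟩
  obtain ⟨x, hx, hx0⟩ := hex
  refine ⟨x, ⟨hx, hx0⟩, ?_⟩
  rintro y ⟨hy, hy0⟩
  rcases lt_trichotomy x y with h | h | h
  · exact (hlt x y hx h hx0 hy0).elim
  · exact h.symm
  · exact (hlt y x hy h hy0 hx0).elim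

/-- The number `ω_k`: the unique positive root of `T_k`. -/
def omegaRoot (k : ℕ) : ℝ :=
  (existsUnique_pos_root k).choose

end GroupGrowth

end

/-! `G` acts on the Bass–Serre tree of the extension. Each vertex has one parent and `p` children,
the action fixes the end reached through the parents, and `tau` measures descent. After inverting
some generators, each of them maps every sufficiently high vertex to itself or to a descendant.
Descend from such a vertex along the axis of a hyperbolic generator `a`. At some point a generator
`b` diverges from `a`: it fixes the current vertex and rotates its branches, or moves the vertex
into another branch. Otherwise `G` would preserve the ray, although vertex stabilizers rotate
branches (`exists_diverging_pair`).

By ping-pong, elements moving one vertex into distinct branches freely generate a monoid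
(`injective_prod_of_descends`). If their lengths are at most `n i` and `∑ z ^ n i ≥ 1`, the growth
rate is at least `1 / z` (`growthRate_ge_of_code`). For elliptic `b`, take the `p = 2k + 1` elements
`b ^ i * a` with `|i| ≤ k`: the equation `z + 2(z² + ... + z^(k+1)) = 1` is that of `1 / ω_k`. For
`p = 2`, the elements `a` and `b * a` give `z + z² = 1`.

If `b` is hyperbolic, `a` and `b` are free generators of a monoid, so the rate is at least `2`,
enough for `p = 2` and `p = 3`. For `p ≥ 5` and equal translation lengths, `b * a⁻¹` is a rotation.
For unequal ones, the bound `1 + √2 ≥ ω_k` is obtained from words in `a` and `b` whose products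
cancel; a finite automaton records the savings (`growthRate_ge_of_automaton`). -/

namespace GroupGrowth

/-! ### Lower bounds for the growth rate -/

section Growth

variable {G : Type*} [Group G] {S : Set G}

theorem wordLength_one_le (S : Set G) : wordLength S (1 : G) ≤ 0 :=
  Nat.sInf_le ⟨[], by simp [IsWord], by simp, by simp⟩

theorem wordLength_le_one {g : G} (hg : g ∈ S ∨ g⁻¹ ∈ S) : wordLength S g ≤ 1 :=
  Nat.sInf_le ⟨[g], by simpa [IsWord] using hg, by simp, by simp⟩

theorem wordLength_mul_le (hS : Subgroup.closure S = ⊤) (x y : G) :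
    wordLength S (x * y) ≤ wordLength S x + wordLength S y := by
  obtain ⟨l, hl, hx, hn⟩ := exists_word_length_eq hS x
  obtain ⟨l', hl', hy, hn'⟩ := exists_word_length_eq hS y
  refine Nat.sInf_le ⟨l ++ l', ?_, by simp [hx, hy], by simp [hn, hn']⟩
  intro z hz
  rcases List.mem_append.1 hz with h | h
  exacts [hl z h, hl' z h]

/-- If the growth rate is less than `1 / z`, then the growth series converges at `z`. -/
theorem exists_sum_pow_wordLength_le (hfin : S.Finite) (hS : Subgroup.closure S = ⊤)
    {z : ℝ} (hz : 0 < z) (hlt : growthRate S < 1 / z) :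
    ∃ C : ℝ, ∀ T : Finset G, ∑ g ∈ T, z ^ wordLength S g ≤ C := by
  -- The slack between the growth rate and `1 / z` lets a geometric series of ratio `r * z < 1`
  -- dominate the growth series.
  obtain ⟨r, hr, hrz⟩ := exists_between hlt
  have hF : ∀ᶠ n : ℕ in atTop, (growthFunction S n : ℝ) ≤ r ^ n := by
    filter_upwards [(tendsto_growthRate hfin hS).eventually (gt_mem_nhds hr),
      eventually_gt_atTop 0] with n hn hn0
    have h0 : (0 : ℝ) ≤ growthFunction S n := Nat.cast_nonneg _
    have := pow_le_pow_left₀ (Real.rpow_nonneg h0 _) hn.le n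
    rwa [one_div, Real.rpow_inv_natCast_pow h0 hn0.ne'] at this
  have hr0 : 0 ≤ r := by
    obtain ⟨n, hn, -⟩ := ((tendsto_growthRate hfin hS).eventually (gt_mem_nhds hr)).and
      (eventually_gt_atTop 0) |>.exists
    exact (Real.rpow_nonneg (Nat.cast_nonneg _) _).trans hn.le
  have hrz1 : r * z < 1 := by rwa [lt_div_iff₀ hz] at hrz
  have hsum : Summable fun n : ℕ => (growthFunction S n : ℝ) * z ^ n := by
    refine Summable.of_norm_bounded_eventually_nat
      (summable_geometric_of_lt_one (mul_nonneg hr0 hz.le) hrz1) ?_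
    filter_upwards [hF] with n hn
    rw [Real.norm_of_nonneg (by positivity), mul_pow]
    gcongr
  refine ⟨∑' n, (growthFunction S n : ℝ) * z ^ n, fun T => ?_⟩
  classical
  have hle : ∀ n, ((T.filter fun g => wordLength S g = n).card : ℝ) ≤ growthFunction S n := by
    intro n
    rw [Nat.cast_le, growthFunction, ← Set.ncard_coe_finset]
    refine Set.ncard_le_ncard ?_ (finite_ball hfin hS n)
    intro g hg
    have := (Finset.mem_filter.1 (Finset.mem_coe.1 hg)).2
    exact this.le
  calc ∑ g ∈ T, z ^ wordLength S g
      = ∑ n ∈ T.image (wordLength S), ∑ g ∈ T with wordLength S g = n, z ^ wordLength S g :=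
        (Finset.sum_fiberwise_of_maps_to (fun g hg => Finset.mem_image_of_mem _ hg) _).symm
    _ ≤ ∑ n ∈ T.image (wordLength S), (growthFunction S n : ℝ) * z ^ n := by
        refine Finset.sum_le_sum fun n _ => ?_
        rw [Finset.sum_congr rfl (g := fun _ => z ^ n)
          (fun g hg => by rw [(Finset.mem_filter.1 hg).2]), Finset.sum_const, nsmul_eq_mul]
        gcongr
        exact_mod_cast hle n
    _ ≤ _ := hsum.sum_le_tsum _ fun n _ => by positivity

/-- A lower bound for the growth rate from a finite automaton that reads words in elements
`g i` which freely generate a monoid. The state `s` reached with total cost `c` at `x` entails the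
invariant `Inv s c x`, which bounds the length of `x` by `c`. If `f` is a positive subharmonic
weight at `z`, then the growth rate is at least `1 / z`. -/
theorem growthRate_ge_of_automaton (hfin : S.Finite) (hS : Subgroup.closure S = ⊤)
    {ι σ : Type*} [Fintype ι] (g : ι → G)
    (hfree : Function.Injective fun l : List ι => (l.map g).prod)
    (step : σ → ι → σ) (cost : σ → ι → ℤ) (Inv : σ → ℤ → G → Prop)
    (hlen : ∀ s c x, Inv s c x → (wordLength S x : ℤ) ≤ c)
    (hstep : ∀ s c x i, Inv s c x → Inv (step s i) (c + cost s i) (x * g i))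
    (s₀ : σ) (h₀ : Inv s₀ 0 1) {z : ℝ} (hz : 0 < z) (hz1 : z ≤ 1) (f : σ → ℝ) (A : ℝ)
    (hf₀ : 0 < f s₀) (hfA : ∀ s, f s ≤ A)
    (hf : ∀ s, f s ≤ ∑ i, z ^ cost s i * f (step s i)) :
    1 / z ≤ growthRate S := by
  classical
  by_contra! hlt
  obtain ⟨C, hC⟩ := exists_sum_pow_wordLength_le hfin hS hz hlt
  have hA : 0 < A := hf₀.trans_le (hfA s₀)
  -- Subharmonicity of `f` says that the total weight of the words with `j` further letters does not
  -- decrease with `j`.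
  have key : ∀ (j : ℕ) (s : σ) (c : ℤ) (x : G), Inv s c x → ∃ T : Finset G,
      (∀ y ∈ T, ∃ l : List ι, l.length = j ∧ y = x * (l.map g).prod) ∧
      f s * z ^ c ≤ A * ∑ y ∈ T, z ^ wordLength S y := by
    intro j
    induction j with
    | zero =>
      intro s c x hx
      refine ⟨{x}, fun y hy => ⟨[], rfl, by simpa using hy⟩, ?_⟩
      rw [Finset.sum_singleton, ← zpow_natCast]
      refine mul_le_mul (hfA s) ?_ (by positivity) hA.le
      exact zpow_le_zpow_right_of_le_one₀ hz hz1 (hlen s c x hx)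
    | succ j ih =>
      intro s c x hx
      choose T hT hTs using fun i => ih _ _ _ (hstep s c x i hx)
      refine ⟨Finset.univ.biUnion T, ?_, ?_⟩
      · intro y hy
        obtain ⟨i, -, hi⟩ := Finset.mem_biUnion.1 hy
        obtain ⟨l, hl, rfl⟩ := hT i y hi
        exact ⟨i :: l, by simp [hl], by simp [mul_assoc]⟩
      · rw [Finset.sum_biUnion, Finset.mul_sum]
        · calc f s * z ^ c ≤ (∑ i, z ^ cost s i * f (step s i)) * z ^ c := by
                gcongr
                exact hf s
            _ = ∑ i, f (step s i) * z ^ (c + cost s i) := by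
                rw [Finset.sum_mul]
                refine Finset.sum_congr rfl fun i _ => ?_
                rw [zpow_add₀ hz.ne']
                ring
            _ ≤ _ := Finset.sum_le_sum fun i _ => hTs i
        · intro i _ i' _ hne
          rw [Function.onFun, Finset.disjoint_left]
          intro y hy hy'
          obtain ⟨l, -, rfl⟩ := hT i y hy
          obtain ⟨l', -, h⟩ := hT i' _ hy'
          have : (fun l : List ι => (l.map g).prod) (i :: l) =
              (fun l : List ι => (l.map g).prod) (i' :: l') := by
            simpa [mul_assoc] using h
          exact hne (List.cons.inj (hfree this)).1
  choose T hT hTs using fun j => key j s₀ 0 1 h₀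
  have hdisj : ∀ j j', j ≠ j' → Disjoint (T j) (T j') := by
    intro j j' hne
    rw [Finset.disjoint_left]
    intro y hy hy'
    obtain ⟨l, hl, rfl⟩ := hT j y hy
    obtain ⟨l', hl', h⟩ := hT j' _ hy'
    have : l = l' := hfree (by simpa using h)
    exact hne (by rw [← hl, ← hl', this])
  -- By freeness the levels `T j` are disjoint, and each contributes at least `f s₀ / A` to the
  -- growth series, which therefore diverges at `z`.
  have hJ : ∀ J : ℕ, (J : ℝ) * f s₀ ≤ A * C := by
    intro J
    calc (J : ℝ) * f s₀ = ∑ j ∈ Finset.range J, f s₀ * z ^ (0 : ℤ) := by simp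
      _ ≤ ∑ j ∈ Finset.range J, A * ∑ y ∈ T j, z ^ wordLength S y :=
          Finset.sum_le_sum fun j _ => hTs j
      _ = A * ∑ y ∈ (Finset.range J).biUnion T, z ^ wordLength S y := by
          rw [← Finset.mul_sum, Finset.sum_biUnion fun j _ j' _ h => hdisj j j' h]
      _ ≤ A * C := by
          gcongr
          exact hC _
  obtain ⟨J, hJ'⟩ := exists_nat_gt (A * C / f s₀)
  rw [div_lt_iff₀ hf₀] at hJ'
  exact absurd (hJ J) (not_le.2 hJ')

/-- If the elements `g i` freely generate a monoid and have length at most `n i`, where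
`∑ i, z ^ n i ≥ 1`, then the growth rate is at least `1 / z`. -/
theorem growthRate_ge_of_code (hfin : S.Finite) (hS : Subgroup.closure S = ⊤)
    {ι : Type*} [Fintype ι] (g : ι → G)
    (hfree : Function.Injective fun l : List ι => (l.map g).prod)
    (n : ι → ℕ) (hn : ∀ i, wordLength S (g i) ≤ n i) {z : ℝ} (hz : 0 < z) (hz1 : z ≤ 1)
    (hsum : 1 ≤ ∑ i, z ^ n i) : 1 / z ≤ growthRate S := by
  refine growthRate_ge_of_automaton hfin hS g hfree (σ := Unit) (fun _ _ => ())
    (fun _ i => n i) (fun _ c x => (wordLength S x : ℤ) ≤ c) (fun _ _ _ h => h) ?_ ()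
    (by exact_mod_cast wordLength_one_le S) hz hz1 (fun _ => 1) 1 one_pos (fun _ => le_rfl)
    (fun _ => by simpa using hsum)
  intro _ c x i hx
  have := wordLength_mul_le hS x (g i)
  have := hn i
  omega

end Growth

/-! ### Ascending HNN extensions and descent in the tree -/

/-- A group `G` generated by (the image of) `H` and an element `t` that acts on `H` by an injective
endomorphism `Θ` whose image is the kernel of a nontrivial character `χ : H → ℤ/p`; the
homomorphism `τ : G → ℤ` kills `H` and maps `t` to `1`. -/
structure AscendingHNN (H G : Type*) [Group H] [Group G] (p : ℕ) where
  incl : H →* G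
  incl_injective : Function.Injective incl
  t : G
  endo : H →* H
  t_mul_incl : ∀ h, t * incl h = incl (endo h) * t
  chi : H →* Multiplicative (ZMod p)
  chi_eq_one_iff : ∀ h, chi h = 1 ↔ ∃ h', endo h' = h
  exists_chi_ne_one : ∃ h, chi h ≠ 1
  tau : G →* Multiplicative ℤ
  tau_t : tau t = Multiplicative.ofAdd 1
  tau_incl : ∀ h, tau (incl h) = 1
  closure_eq_top : Subgroup.closure (Set.range incl ∪ {t}) = ⊤

namespace AscendingHNN

variable {H G : Type*} [Group H] [Group G] {p : ℕ} (E : AscendingHNN H G p)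

theorem chi_endo (h : H) : E.chi (E.endo h) = 1 :=
  (E.chi_eq_one_iff _).2 ⟨h, rfl⟩

theorem t_pow_mul_incl (n : ℕ) (h : H) :
    E.t ^ n * E.incl h = E.incl (E.endo^[n] h) * E.t ^ n := by
  induction n generalizing h with
  | zero => simp
  | succ n ih =>
    rw [pow_succ, mul_assoc, E.t_mul_incl, ← mul_assoc, ih, mul_assoc,
      Function.iterate_succ_apply]

theorem chi_iterate_endo {n : ℕ} (hn : 0 < n) (h : H) : E.chi (E.endo^[n] h) = 1 := by
  obtain ⟨n, rfl⟩ := Nat.exists_eq_succ_of_ne_zero hn.ne'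
  rw [Function.iterate_succ_apply', chi_endo]

theorem incl_mul_t_pow_inj {h h' : H} {n n' : ℕ}
    (e : E.incl h * E.t ^ n = E.incl h' * E.t ^ n') : n = n' ∧ h = h' := by
  have hn : n = n' := by
    have := congrArg E.tau e
    simpa [E.tau_incl, E.tau_t, ← ofAdd_nsmul] using this
  subst hn
  exact ⟨rfl, E.incl_injective (mul_right_cancel e)⟩

/-- In the action on the Bass–Serre tree, `E.Descends u g n c` says that `g` maps the vertex with
stabilizer `u H u⁻¹` to a descendant at distance `n`; for `n > 0` this descendant lies in the branch
with label `c`, and for `n = 0` the element `g` shifts the labels of the branches by `c`. -/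
def Descends (u g : G) (n : ℕ) (c : ZMod p) : Prop :=
  ∃ h, u⁻¹ * g * u = E.incl h * E.t ^ n ∧ E.chi h = Multiplicative.ofAdd c

variable {E} {u g g' : G} {n n' : ℕ} {c c' : ZMod p}

theorem Descends.unique (h : E.Descends u g n c) (h' : E.Descends u g n' c') :
    n = n' ∧ c = c' := by
  obtain ⟨x, hx, hc⟩ := h
  obtain ⟨x', hx', hc'⟩ := h'
  obtain ⟨h1, h2⟩ := E.incl_mul_t_pow_inj (hx.symm.trans hx')
  subst h2
  exact ⟨h1, Multiplicative.ofAdd.injective (hc.symm.trans hc')⟩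

theorem descends_one : E.Descends u 1 0 0 := ⟨1, by simp, by simp⟩

theorem Descends.mul (hn : 0 < n) (h : E.Descends u g n c) (h' : E.Descends u g' n' c') :
    E.Descends u (g * g') (n + n') c := by
  obtain ⟨x, hx, hc⟩ := h
  obtain ⟨x', hx', -⟩ := h'
  refine ⟨x * E.endo^[n] x', ?_, by rw [map_mul, E.chi_iterate_endo hn, mul_one, hc]⟩
  calc u⁻¹ * (g * g') * u = (u⁻¹ * g * u) * (u⁻¹ * g' * u) := by group
    _ = E.incl x * (E.t ^ n * E.incl x') * E.t ^ n' := by rw [hx, hx']; group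
    _ = _ := by rw [t_pow_mul_incl, map_mul, pow_add]; group

theorem Descends.zero_mul (h : E.Descends u g 0 c) (h' : E.Descends u g' n c') :
    E.Descends u (g * g') n (c + c') := by
  obtain ⟨x, hx, hc⟩ := h
  obtain ⟨x', hx', hc'⟩ := h'
  refine ⟨x * x', ?_, by rw [map_mul, hc, hc', ofAdd_add]⟩
  calc u⁻¹ * (g * g') * u = (u⁻¹ * g * u) * (u⁻¹ * g' * u) := by group
    _ = _ := by rw [hx, hx', map_mul]; group

theorem Descends.zero_inv (h : E.Descends u g 0 c) : E.Descends u g⁻¹ 0 (-c) := by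
  obtain ⟨x, hx, hc⟩ := h
  refine ⟨x⁻¹, ?_, by rw [map_inv, hc, ofAdd_neg]⟩
  calc u⁻¹ * g⁻¹ * u = (u⁻¹ * g * u)⁻¹ := by group
    _ = _ := by rw [hx, map_inv]; group

theorem Descends.zero_pow (h : E.Descends u g 0 c) (i : ℕ) :
    E.Descends u (g ^ i) 0 (i * c) := by
  induction i with
  | zero => simpa using descends_one
  | succ i ih =>
    rw [pow_succ']
    convert h.zero_mul ih using 1
    push_cast
    ring

/-- The inverse of `g'` sends the vertex to its ancestor at distance `n'`, so `g * g'⁻¹` sends it to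
the ancestor of its `g`-image at that distance. As `n' < n`, this lies strictly below the vertex,
still in the branch of `g`. -/
theorem Descends.div (h : E.Descends u g n c) (h' : E.Descends u g' n' c') (hn : n' < n) :
    E.Descends u (g * g'⁻¹) (n - n') c := by
  obtain ⟨x, hx, hc⟩ := h
  obtain ⟨x', hx', -⟩ := h'
  obtain ⟨d, rfl⟩ := Nat.exists_eq_add_of_lt hn
  have e : n' + d + 1 - n' = d + 1 := by omega
  rw [e]
  refine ⟨x * E.endo^[d + 1] x'⁻¹, ?_,
    by rw [map_mul, E.chi_iterate_endo (Nat.succ_pos d), mul_one, hc]⟩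
  calc u⁻¹ * (g * g'⁻¹) * u = (u⁻¹ * g * u) * (u⁻¹ * g' * u)⁻¹ := by group
    _ = E.incl x * (E.t ^ (d + 1) * E.incl x'⁻¹) := by
      rw [hx, hx', map_inv, show n' + d + 1 = (d + 1) + n' by omega, pow_add]; group
    _ = _ := by rw [t_pow_mul_incl, map_mul]; group

theorem Descends.div_zero (h : E.Descends u g n c) (h' : E.Descends u g' n c') :
    E.Descends u (g * g'⁻¹) 0 (c - c') := by
  obtain ⟨x, hx, hc⟩ := h
  obtain ⟨x', hx', hc'⟩ := h'
  refine ⟨x * x'⁻¹, ?_, by rw [map_mul, map_inv, hc, hc', ofAdd_sub, div_eq_mul_inv]⟩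
  calc u⁻¹ * (g * g'⁻¹) * u = (u⁻¹ * g * u) * (u⁻¹ * g' * u)⁻¹ := by group
    _ = _ := by rw [hx, hx', map_mul, map_inv]; group

/-- Elements that move a vertex to descendants in distinct branches freely generate a monoid. -/
theorem injective_prod_of_descends {ι : Type*} {g : ι → G} {n : ι → ℕ} {c : ι → ZMod p}
    (hn : ∀ i, 0 < n i) (hg : ∀ i, E.Descends u (g i) (n i) (c i))
    (hc : Function.Injective c) : Function.Injective fun l : List ι => (l.map g).prod := by
  have hD : ∀ l : List ι, ∃ m c, E.Descends u (l.map g).prod m c := by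
    intro l
    induction l with
    | nil => exact ⟨0, 0, by simpa using descends_one⟩
    | cons i l ih =>
      obtain ⟨m, d, h⟩ := ih
      exact ⟨n i + m, c i, by simpa using (hg i).mul (hn i) h⟩
  have hcons : ∀ i l, ∃ m, 0 < m ∧ E.Descends u ((i :: l).map g).prod m (c i) := by
    intro i l
    obtain ⟨m, d, h⟩ := hD l
    exact ⟨n i + m, by have := hn i; omega, by simpa using (hg i).mul (hn i) h⟩
  have hnil : ∀ i l, ((i :: l).map g).prod ≠ 1 := by
    intro i l e
    obtain ⟨m, hm, h⟩ := hcons i l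
    rw [e] at h
    exact hm.ne' (h.unique descends_one).1
  intro l
  induction l with
  | nil =>
    intro l' e
    cases l' with
    | nil => rfl
    | cons i l' => exact (hnil i l' e.symm).elim
  | cons i l ih =>
    intro l' e
    cases l' with
    | nil => exact (hnil i l e).elim
    | cons i' l' =>
      obtain ⟨m, -, h⟩ := hcons i l
      obtain ⟨m', -, h'⟩ := hcons i' l'
      have e' : ((i :: l).map g).prod = ((i' :: l').map g).prod := e
      rw [e'] at h
      -- Ping-pong: the branch containing the image of the vertex determines the first letter.
      obtain rfl := hc (h.unique h').2
      rw [ih (by simpa using e')]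

/-! ### Diverging generators -/

variable (E)

theorem exists_eq_conj (g : G) :
    ∃ (i j : ℕ) (h : H), g = (E.t ^ i)⁻¹ * E.incl h * E.t ^ j := by
  have hg : g ∈ Subgroup.closure (Set.range E.incl ∪ {E.t}) := by
    rw [E.closure_eq_top]; trivial
  induction hg using Subgroup.closure_induction with
  | mem x hx =>
    rcases hx with ⟨h, rfl⟩ | rfl
    · exact ⟨0, 0, h, by simp⟩
    · exact ⟨0, 1, 1, by simp⟩
  | one => exact ⟨0, 0, 1, by simp⟩
  | inv x _ ih =>
    obtain ⟨i, j, h, rfl⟩ := ih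
    exact ⟨j, i, h⁻¹, by rw [map_inv]; group⟩
  | mul x y _ _ ihx ihy =>
    obtain ⟨i, j, h, rfl⟩ := ihx
    obtain ⟨i', j', h', rfl⟩ := ihy
    rcases le_total i' j with hle | hle
    · obtain ⟨d, rfl⟩ := Nat.exists_eq_add_of_le' hle
      refine ⟨i, d + j', h * E.endo^[d] h', ?_⟩
      have := E.t_pow_mul_incl d h'
      calc _ = (E.t ^ i)⁻¹ * E.incl h * (E.t ^ d * E.incl h') * E.t ^ j' := by
            rw [pow_add]; group
        _ = _ := by rw [this, map_mul, pow_add]; group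
    · obtain ⟨d, rfl⟩ := Nat.exists_eq_add_of_le' hle
      refine ⟨d + i, j', E.endo^[d] h * h', ?_⟩
      have : E.incl (E.endo^[d] h) = E.t ^ d * E.incl h * (E.t ^ d)⁻¹ := by
        rw [E.t_pow_mul_incl]; group
      rw [map_mul, this, pow_add, pow_add]
      group

/-- The vertices `t⁻ʲ` climb to the fixed end, where their ray merges with its `g`-translate. Having
this for all large `j` allows one vertex to serve finitely many generators. -/
theorem exists_conj_eq {g : G} {n : ℕ} (hg : E.tau g = Multiplicative.ofAdd (n : ℤ)) :
    ∃ i : ℕ, ∀ j, i ≤ j → ∃ h, E.t ^ j * g * (E.t ^ j)⁻¹ = E.incl h * E.t ^ n := by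
  obtain ⟨i, k, h, rfl⟩ := E.exists_eq_conj g
  have hk : k = i + n := by
    simp only [map_mul, map_inv, map_pow, E.tau_incl, E.tau_t, ← ofAdd_nsmul, ← ofAdd_neg, mul_one,
      ← ofAdd_add] at hg
    have := Multiplicative.ofAdd.injective hg
    simp at this
    omega
  subst hk
  refine ⟨i, fun j hj => ?_⟩
  obtain ⟨d, rfl⟩ := Nat.exists_eq_add_of_le' hj
  refine ⟨E.endo^[d] h, ?_⟩
  calc _ = (E.t ^ d * E.incl h) * (E.t ^ d)⁻¹ * E.t ^ n := by
        rw [pow_add, pow_add]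
        have : E.t ^ i * E.t ^ n = E.t ^ n * E.t ^ i := by rw [← pow_add, ← pow_add, add_comm]
        have h2 : E.t ^ d * E.t ^ n = E.t ^ n * E.t ^ d := by rw [← pow_add, ← pow_add, add_comm]
        rw [this]
        have h3 : (E.t ^ d)⁻¹ * E.t ^ n = E.t ^ n * (E.t ^ d)⁻¹ := by
          rw [inv_mul_eq_iff_eq_mul, ← mul_assoc, h2]; group
        rw [mul_assoc _ (E.t ^ d)⁻¹, h3]
        group
    _ = _ := by rw [E.t_pow_mul_incl]; group

/-- A group containing a vertex stabilizer does not preserve a descending ray. -/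
theorem not_preserves_ray (u : ℕ → G) (k : ℕ → H)
    (hu : ∀ j, u (j + 1) = u j * (E.incl (k j) * E.t)) (S : Set G)
    (hS : Subgroup.closure S = ⊤)
    (hP : ∀ g ∈ S, ∃ n : ℕ, ∀ j, ∃ h, (u j)⁻¹ * g * u j = E.incl h * E.t ^ n) : False := by
  have hq : ∀ j n, ∃ h, u (j + n) = u j * (E.incl h * E.t ^ n) := by
    intro j n
    induction n with
    | zero => exact ⟨1, by simp⟩
    | succ n ih =>
      obtain ⟨h, e⟩ := ih
      refine ⟨h * E.endo^[n] (k (j + n)), ?_⟩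
      have := E.t_pow_mul_incl n (k (j + n))
      calc _ = u j * (E.incl h * (E.t ^ n * E.incl (k (j + n))) * E.t) := by
            rw [← add_assoc, hu, e]; group
        _ = _ := by rw [this, map_mul, pow_succ]; group
  -- Preserving the ray up to a shift in either direction is stable under inverses, unlike moving
  -- its vertices to descendants.
  have hQ : ∀ g : G, ∃ n n' : ℕ, ∀ j, ∃ h, g * u (j + n') = u (j + n) * E.incl h := by
    intro g
    have hg : g ∈ Subgroup.closure S := by rw [hS]; trivial
    induction hg using Subgroup.closure_induction with
    | mem x hx =>
      obtain ⟨n, hn⟩ := hP x hx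
      refine ⟨n, 0, fun j => ?_⟩
      obtain ⟨h, e⟩ := hn (j + n)
      obtain ⟨h', e'⟩ := hq j n
      refine ⟨h * h'⁻¹, ?_⟩
      have e1 : x * u (j + n) = u (j + n) * (E.incl h * E.t ^ n) := by rw [← e]; group
      have e2 : u j = u (j + n) * (E.t ^ n)⁻¹ * (E.incl h')⁻¹ := by rw [e']; group
      calc x * u (j + 0) = (x * u (j + n)) * (E.t ^ n)⁻¹ * (E.incl h')⁻¹ := by
            rw [add_zero, e2]
            group
        _ = _ := by rw [e1, map_mul, map_inv]; group
    | one => exact ⟨0, 0, fun j => ⟨1, by simp⟩⟩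
    | inv x _ ih =>
      obtain ⟨n, n', h⟩ := ih
      refine ⟨n', n, fun j => ?_⟩
      obtain ⟨y, e⟩ := h j
      refine ⟨y⁻¹, ?_⟩
      rw [inv_mul_eq_iff_eq_mul, ← mul_assoc, e, map_inv]
      group
    | mul x y _ _ ihx ihy =>
      obtain ⟨n, n', h⟩ := ihx
      obtain ⟨m, m', h'⟩ := ihy
      refine ⟨n + m, n' + m', fun j => ?_⟩
      obtain ⟨b, e⟩ := h (j + m)
      obtain ⟨b', e'⟩ := h' (j + n')
      refine ⟨b * b', ?_⟩
      rw [← add_assoc, mul_assoc, e', ← mul_assoc, show j + n' + m = j + m + n' by omega, e,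
        show j + m + n = j + (n + m) by omega, map_mul, mul_assoc]
  obtain ⟨k₀, hk₀⟩ := E.exists_chi_ne_one
  -- This element fixes `u 0` but shifts its branches by `chi k₀ ≠ 1`, so it cannot preserve the
  -- ray.
  obtain ⟨n, n', h⟩ := hQ (u 0 * E.incl k₀ * (u 0)⁻¹)
  -- Index `1` rather than `0` makes the exponent `1 + n` positive, so that `chi` kills the iterate
  -- of `endo` even when `n = 0`.
  obtain ⟨b, e⟩ := h 1
  obtain ⟨x, hx⟩ := hq 0 (1 + n)
  obtain ⟨x', hx'⟩ := hq 0 (1 + n')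
  rw [zero_add] at hx hx'
  rw [hx, hx'] at e
  have e1 : E.incl (k₀ * x') * E.t ^ (1 + n') = E.incl (x * E.endo^[1 + n] b) * E.t ^ (1 + n) := by
    have h1 : u 0 * (E.incl (k₀ * x') * E.t ^ (1 + n')) =
        u 0 * (E.incl x * (E.t ^ (1 + n) * E.incl b)) := by
      rw [map_mul]
      calc _ = u 0 * E.incl k₀ * (u 0)⁻¹ * (u 0 * (E.incl x' * E.t ^ (1 + n'))) := by group
        _ = _ := by rw [e]; group
    rw [mul_left_cancel h1, E.t_pow_mul_incl, map_mul]
    group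
  obtain ⟨hn, e2⟩ := E.incl_mul_t_pow_inj e1
  obtain rfl : n' = n := by omega
  obtain ⟨-, rfl⟩ := E.incl_mul_t_pow_inj (mul_left_cancel (hx.symm.trans hx'))
  have := congrArg E.chi e2
  rw [map_mul, map_mul, E.chi_iterate_endo (by omega), mul_one] at this
  exact hk₀ (mul_eq_right.1 this)

/-- If `g` moves a vertex along the branch of the hyperbolic element `k t ^ m`, or fixes all of its
branches, then it also moves the first vertex on that branch to a descendant. -/
theorem exists_conj_child {u g : G} {k h : H} {n : ℕ} (hg : u⁻¹ * g * u = E.incl h * E.t ^ n)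
    (hc : n = 0 → E.chi h = 1) (hc' : 0 < n → E.chi h = E.chi k) :
    ∃ h', (u * (E.incl k * E.t))⁻¹ * g * (u * (E.incl k * E.t)) = E.incl h' * E.t ^ n := by
  have e : (u * (E.incl k * E.t))⁻¹ * g * (u * (E.incl k * E.t)) =
      E.t⁻¹ * E.incl k⁻¹ * (E.incl h * E.t ^ n) * E.incl k * E.t := by
    rw [← hg, map_inv]; group
  rw [e]
  -- In both cases an element of `ker chi`, the image of `endo`, appears next to `t⁻¹`, which can
  -- then be moved past it.
  rcases n with _ | n
  · obtain ⟨b, hb⟩ := (E.chi_eq_one_iff (k⁻¹ * h * k)).1 (by simp [hc rfl])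
    refine ⟨b, ?_⟩
    calc _ = E.t⁻¹ * (E.incl (k⁻¹ * h * k) * E.t) := by simp only [map_mul]; group
      _ = _ := by rw [← hb, ← E.t_mul_incl]; group
  · obtain ⟨b, hb⟩ := (E.chi_eq_one_iff (k⁻¹ * h)).1 (by simp [hc' (Nat.succ_pos n)])
    refine ⟨b * E.endo^[n] k, ?_⟩
    have h1 : E.t⁻¹ * E.incl (k⁻¹ * h) = E.incl b * E.t⁻¹ := by
      rw [← hb, inv_mul_eq_iff_eq_mul, ← mul_assoc, E.t_mul_incl]; group
    calc _ = (E.t⁻¹ * E.incl (k⁻¹ * h)) * E.t * (E.t ^ n * E.incl k) * E.t := by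
          rw [map_mul, pow_succ']; group
      _ = _ := by rw [h1, E.t_pow_mul_incl, map_mul, pow_succ]; group

/-- Every finite generating set contains, up to inversion, a hyperbolic element `a` and an
element `b` such that some vertex on the axis of `a` is either fixed by `b`, its branches being
permuted nontrivially, or moved by `b` into a branch other than that of `a`. -/
theorem exists_diverging_pair {S : Set G} (hfin : S.Finite) (hS : Subgroup.closure S = ⊤) :
    ∃ (u a b : G) (m n : ℕ) (c d : ZMod p), (a ∈ S ∨ a⁻¹ ∈ S) ∧ (b ∈ S ∨ b⁻¹ ∈ S) ∧ 0 < m ∧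
      E.Descends u a m c ∧ E.Descends u b n d ∧ (n = 0 ∧ d ≠ 0 ∨ 0 < n ∧ c ≠ d) := by
  -- Orient the generators: of each generator and its inverse, keep those that do not ascend.
  set S' : Set G := {g | (g ∈ S ∨ g⁻¹ ∈ S) ∧ ∃ n : ℕ, E.tau g = Multiplicative.ofAdd (n : ℤ)}
    with hS'
  have hsign : ∀ g ∈ S, g ∈ S' ∨ g⁻¹ ∈ S' := by
    intro g hg
    obtain ⟨n, hn | hn⟩ := (Multiplicative.toAdd (E.tau g)).eq_nat_or_neg
    · exact Or.inl ⟨Or.inl hg, n, by rw [← hn]; rfl⟩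
    · exact Or.inr ⟨Or.inr (by simpa using hg), n, by
        rw [map_inv, ← ofAdd_toAdd (E.tau g), hn, ofAdd_neg, inv_inv]⟩
  have hclosure : Subgroup.closure S' = ⊤ := by
    rw [eq_top_iff, ← hS, Subgroup.closure_le]
    intro g hg
    rcases hsign g hg with h | h
    · exact Subgroup.subset_closure h
    · simpa using Subgroup.inv_mem _ (Subgroup.subset_closure h)
  have hfin' : S'.Finite := by
    refine (hfin.union (hfin.image fun x => x⁻¹)).subset ?_
    rintro g ⟨h | h, -⟩
    · exact Or.inl h
    · exact Or.inr ⟨g⁻¹, h, inv_inv g⟩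
  obtain ⟨a, ha, m, hm, hta⟩ : ∃ a ∈ S', ∃ m : ℕ,
      0 < m ∧ E.tau a = Multiplicative.ofAdd (m : ℤ) := by
    by_contra! hno
    have hker : Subgroup.closure S' ≤ E.tau.ker := by
      rw [Subgroup.closure_le]
      rintro g ⟨hg, n, hn⟩
      rcases Nat.eq_zero_or_pos n with rfl | h0
      · simpa using hn
      · exact (hno g ⟨hg, n, hn⟩ n h0 hn).elim
    rw [hclosure] at hker
    have := hker (Subgroup.mem_top E.t)
    rw [MonoidHom.mem_ker, E.tau_t] at this
    exact absurd (Multiplicative.ofAdd.injective this) one_ne_zero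
  by_contra hcon
  -- Every oriented generator maps the vertex `u` to itself or to a descendant. Without a diverging
  -- pair, `P` passes to the child on the axis of `a`, so iteration yields a ray preserved by all of
  -- them.
  let P : G → Prop := fun u => ∀ g ∈ S', ∀ n : ℕ, E.tau g = Multiplicative.ofAdd (n : ℤ) →
    ∃ h, u⁻¹ * g * u = E.incl h * E.t ^ n
  have hP₀ : ∃ u, P u := by
    have : ∀ g ∈ S', ∀ᶠ j : ℕ in atTop, ∀ n : ℕ, E.tau g = Multiplicative.ofAdd (n : ℤ) →
        ∃ h, E.t ^ j * g * (E.t ^ j)⁻¹ = E.incl h * E.t ^ n := by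
      rintro g ⟨-, n, hn⟩
      obtain ⟨i, hi⟩ := E.exists_conj_eq hn
      filter_upwards [eventually_ge_atTop i] with j hj n' hn'
      obtain rfl : n = n' := by
        simpa using Multiplicative.ofAdd.injective (hn.symm.trans hn')
      exact hi j hj
    obtain ⟨j, hj⟩ := ((eventually_all_finite hfin').2 this).exists
    exact ⟨(E.t ^ j)⁻¹, fun g hg n hn => by simpa using hj g hg n hn⟩
  have hstep : ∀ u, P u → ∃ k, P (u * (E.incl k * E.t)) := by
    intro u hu
    obtain ⟨k, hk⟩ := hu a ha m hta
    refine ⟨k, fun g hg n hn => ?_⟩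
    obtain ⟨h, hh⟩ := hu g hg n hn
    have hDa : E.Descends u a m (Multiplicative.toAdd (E.chi k)) := ⟨k, hk, rfl⟩
    have hDg : E.Descends u g n (Multiplicative.toAdd (E.chi h)) := ⟨h, hh, rfl⟩
    refine E.exists_conj_child hh ?_ ?_
    · intro h0
      by_contra hne
      exact hcon ⟨u, a, g, m, n, _, _, ha.1, hg.1, hm, hDa, hDg, Or.inl ⟨h0, hne⟩⟩
    · intro h0
      by_contra hne
      exact hcon ⟨u, a, g, m, n, _, _, ha.1, hg.1, hm, hDa, hDg, Or.inr ⟨h0, fun e => hne e.symm⟩⟩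
  obtain ⟨u₀, hu₀⟩ := hP₀
  choose k hk using fun u : {u // P u} => hstep u.1 u.2
  let next : {u // P u} → {u // P u} := fun u => ⟨u.1 * (E.incl (k u) * E.t), hk u⟩
  refine E.not_preserves_ray (fun j => (next^[j] ⟨u₀, hu₀⟩).1) (fun j => k (next^[j] ⟨u₀, hu₀⟩))
    (fun j => by rw [Function.iterate_succ_apply']) S' hclosure ?_
  rintro g hg
  obtain ⟨n, hn⟩ := hg.2
  exact ⟨n, fun j => (next^[j] ⟨u₀, hu₀⟩).2 g hg n hn⟩

end AscendingHNN

/-! ### The given HNN extension as an `AscendingHNN` -/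

open HNNExtension in
/-- The HNN extension of a group relative to an isomorphism onto a normal subgroup of prime
index. -/
theorem nonempty_ascendingHNN {H : Type*} [Group H] (B : Subgroup H) [B.Normal]
    (θ : (⊤ : Subgroup H) ≃* B) {p : ℕ} (hp : p.Prime) (hB : B.index = p) :
    Nonempty (AscendingHNN H (HNNExtension H ⊤ B θ) p) := by
  have : Fact p.Prime := ⟨hp⟩
  -- A group of prime order is cyclic; composed with the quotient map, this is a character with
  -- kernel `B`, the image of `endo`.
  have e : H ⧸ B ≃* Multiplicative (ZMod p) :=
    mulEquivOfPrimeCardEq (p := p) (by rw [← hB]; rfl) (by simp)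
  have hmem : ∀ h : H, e (h : H ⧸ B) = 1 ↔ h ∈ B := fun h => by
    rw [map_eq_one_iff e e.injective, QuotientGroup.eq_one_iff]
  exact ⟨{
    incl := of
    incl_injective := of_injective θ
    t := t
    endo := (B.subtype.comp θ.toMonoidHom).comp (Subgroup.topEquiv (G := H)).symm.toMonoidHom
    t_mul_incl := fun h => t_mul_of (⟨h, Subgroup.mem_top h⟩ : (⊤ : Subgroup H))
    chi := e.toMonoidHom.comp (QuotientGroup.mk' B)
    chi_eq_one_iff := fun h => by
      refine (hmem h).trans ⟨fun hh => ?_, ?_⟩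
      · obtain ⟨x, hx⟩ := θ.surjective ⟨h, hh⟩
        exact ⟨x, congrArg Subtype.val hx⟩
      · rintro ⟨x, rfl⟩
        exact (θ _).2
    exists_chi_ne_one := by
      by_contra! hall
      have : B = ⊤ := eq_top_iff.2 fun h _ => (hmem h).1 (hall h)
      rw [this, Subgroup.index_top] at hB
      exact hp.one_lt.ne hB
    tau := lift 1 (Multiplicative.ofAdd 1) (by simp)
    tau_t := by simp
    tau_incl := by simp
    closure_eq_top := by
      rw [eq_top_iff]
      rintro x -
      induction x using HNNExtension.induction_on with
      | of g => exact Subgroup.subset_closure (Or.inl ⟨g, rfl⟩)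
      | t => exact Subgroup.subset_closure (Or.inr rfl)
      | mul x y hx hy => exact mul_mem hx hy
      | inv x hx => exact inv_mem hx }⟩

/-! ### Hyperbolic pairs with different translation lengths -/

theorem injective_add_intCast_mul {p : ℕ} [Fact p.Prime] {ι : Type*} {e : ι → ℤ}
    (he : Function.Injective e) (hlt : ∀ i j, |e i - e j| < p) (c : ZMod p) {δ : ZMod p}
    (hδ : δ ≠ 0) : Function.Injective fun i => c + e i * δ := by
  intro i j h
  have h1 : ((e i - e j : ℤ) : ZMod p) = 0 := by
    have := mul_right_cancel₀ hδ (add_left_cancel h)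
    push_cast
    rw [this, sub_self]
  rw [ZMod.intCast_zmod_eq_zero_iff_dvd] at h1
  exact he (sub_eq_zero.1 (Int.eq_zero_of_abs_lt_dvd h1 (hlt i j)))

namespace AscendingHNN

variable {H G : Type*} [Group H] [Group G] {p : ℕ} {E : AscendingHNN H G p} {S : Set G}
  {u a b y : G} {m n : ℕ} {c d δ : ZMod p}

/-- The length bound used to follow the cost of a word. -/
theorem wordLength_le_of_eq_mul (hS : Subgroup.closure S = ⊤) {x y : G} {k k' : ℤ} (l : List G)
    (hl : IsWord S l) (hx : (wordLength S x : ℤ) ≤ k) (hy : y = x * l.prod)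
    (hk : k + l.length ≤ k') : (wordLength S y : ℤ) ≤ k' := by
  have h1 := wordLength_mul_le hS x l.prod
  have h2 : wordLength S l.prod ≤ l.length := Nat.sInf_le ⟨l, hl, rfl, rfl⟩
  rw [hy]
  omega

theorem Descends.congr (h : E.Descends u a m c) (hcd : c = d) : E.Descends u a m d :=
  hcd ▸ h

theorem two_le_growthRate (hfin : S.Finite) (hS : Subgroup.closure S = ⊤)
    (ha : a ∈ S ∨ a⁻¹ ∈ S) (hb : b ∈ S ∨ b⁻¹ ∈ S) (hm : 0 < m) (hn : 0 < n)
    (hDa : E.Descends u a m c) (hDb : E.Descends u b n d) (hcd : c ≠ d) :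
    2 ≤ growthRate S := by
  have := growthRate_ge_of_code hfin hS ![a, b]
    (injective_prod_of_descends (E := E) (u := u) (n := ![m, n]) (c := ![c, d])
      (by simp [hm, hn]) (by simp [hDa, hDb])
      (by intro i j; fin_cases i <;> fin_cases j <;> simp [hcd, hcd.symm]))
    (fun _ => 1) (by simp [wordLength_le_one ha, wordLength_le_one hb])
    (z := 1 / 2) (by norm_num) (by norm_num) (by norm_num)
  simpa using this

/-- Both `b * a` and `a * b` descend by `m + n`, into the branches `d` and `c`, so their quotient
fixes the vertex. It supplies a rotation when `b * a⁻¹` is not one. -/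
theorem descends_commutator (hm : 0 < m) (hn : 0 < n) (hDa : E.Descends u a m c)
    (hDb : E.Descends u b n d) : E.Descends u (b * a * b⁻¹ * a⁻¹) 0 (d - c) := by
  have h := (hDb.mul hn hDa).div_zero (by simpa [add_comm] using hDa.mul hm hDb)
  have e : b * a * (a * b)⁻¹ = b * a * b⁻¹ * a⁻¹ := by group
  rwa [e] at h

/-- Basic facts about the number `√2 - 1`. -/
theorem sqrt_two_sub_one_spec {z : ℝ} (hz : z = √2 - 1) :
    0.41421 < z ∧ z < 0.41422 ∧ z ^ 2 = 1 - 2 * z ∧ z⁻¹ = 2 + z := by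
  have h2 : √2 ^ 2 = 2 := Real.sq_sqrt (by norm_num)
  have h0 : 0.41421 < z := by
    rw [hz]
    have : (1.41421 : ℝ) < √2 := Real.lt_sqrt_of_sq_lt (by norm_num)
    linarith
  have h1 : z < 0.41422 := by
    rw [hz]
    have : √2 < (1.41422 : ℝ) := (Real.sqrt_lt' (by norm_num)).2 (by norm_num)
    linarith
  have hsq : z ^ 2 = 1 - 2 * z := by rw [hz]; nlinarith
  refine ⟨h0, h1, hsq, inv_eq_of_mul_eq_one_right ?_⟩
  nlinarith

/-- Here `a²b⁻¹` and `ba⁻¹` both descend, and the commutator rotates the latter into a third branch.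
The lengths 3, 2, 6 alone do not suffice at `√2 - 1`; the cancellations `a⁻¹a`, `b⁻¹b` and `a²b⁻¹ ·
ba⁻¹ = a` make up for it. -/
theorem growthRate_ge_of_lt_two_mul [Fact p.Prime] (hp : 5 ≤ p) (hfin : S.Finite)
    (hS : Subgroup.closure S = ⊤)
    (ha : a ∈ S ∨ a⁻¹ ∈ S) (hb : b ∈ S ∨ b⁻¹ ∈ S) (hm : 0 < m) (hmn : m < n) (hn : n < 2 * m)
    (hDa : E.Descends u a m c) (hDb : E.Descends u b n d) (hcd : c ≠ d) :
    1 / (√2 - 1) ≤ growthRate S := by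
  obtain ⟨z, hz⟩ : ∃ z, z = √2 - 1 := ⟨_, rfl⟩
  obtain ⟨hz0, hz1, hz2, hinv⟩ := sqrt_two_sub_one_spec hz
  rw [← hz]
  have ha' : a⁻¹ ∈ S ∨ a ∈ S := ha.symm
  have hb' : b⁻¹ ∈ S ∨ b ∈ S := hb.symm
  have hw : E.Descends u (b * a⁻¹) (n - m) d := hDb.div hDa hmn
  have hx : E.Descends u (a * a * b⁻¹) (m + m - n) c := (hDa.mul hm hDa).div hDb (by omega)
  have hw₂ := (descends_commutator hm (hm.trans hmn) hDa hDb).zero_mul hw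
  let g : Fin 3 → G := ![a * a * b⁻¹, b * a⁻¹, b * a * b⁻¹ * a⁻¹ * (b * a⁻¹)]
  let e : Fin 3 → ℤ := ![0, 1, 2]
  have hfree : Function.Injective fun l : List (Fin 3) => (l.map g).prod := by
    refine injective_prod_of_descends (E := E) (u := u) (n := ![m + m - n, n - m, n - m])
      (c := fun i => c + e i * (d - c)) ?_ ?_
      (injective_add_intCast_mul (by decide) ?_ c (sub_ne_zero.2 hcd.symm))
    · intro i
      fin_cases i <;> simp <;> omega
    · intro i
      match i with
      | 0 => exact hx.congr (by simp [e])
      | 1 => exact hw.congr (by simp [e])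
      | 2 => exact hw₂.congr (by simp [e]; ring)
    · have : ∀ i j, |e i - e j| < 5 := by decide
      exact fun i j => (this i j).trans_le (by exact_mod_cast hp)
  -- State 1 remembers a final `a⁻¹`, state 2 a final `a²b⁻¹`, state 0 nothing. The weights need
  -- only satisfy the three subharmonicity inequalities at `√2 - 1`.
  refine growthRate_ge_of_automaton hfin hS g hfree (σ := Fin 3)
    ![![2, 1, 1], ![2, 1, 1], ![2, 0, 1]] ![![3, 2, 6], ![1, 2, 6], ![3, -2, 4]]
    (fun s k x => match s with
      | 0 => (wordLength S x : ℤ) ≤ k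
      | 1 => (wordLength S x : ℤ) ≤ k ∧ (wordLength S (x * a) : ℤ) ≤ k - 1
      | 2 => (wordLength S x : ℤ) ≤ k ∧ (wordLength S (x * b) : ℤ) ≤ k - 1 ∧
          (wordLength S (x * (b * a⁻¹)) : ℤ) ≤ k - 2) ?_ ?_ 0
    (by exact_mod_cast wordLength_one_le S) (by linarith) (by linarith)
    ![1, 3.18, 6.35] 6.35 (by simp) ?_ ?_
  · intro s k x h
    match s with
    | 0 => exact h
    | 1 => exact h.1
    | 2 => exact h.1
  · intro s k x i h
    have key := @wordLength_le_of_eq_mul G _ S hS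
    match s, i with
    | 0, 0 =>
      exact ⟨key [a, a, b⁻¹] (by simp [IsWord, *]) h (by simp [g, mul_assoc]) (by simp),
        key [a, a] (by simp [IsWord, *]) h (by simp [g, mul_assoc]) (by simp),
        key [a] (by simp [IsWord, *]) h (by simp [g, mul_assoc]) (by simp; omega)⟩
    | 0, 1 =>
      exact ⟨key [b, a⁻¹] (by simp [IsWord, *]) h (by simp [g, mul_assoc]) (by simp),
        key [b] (by simp [IsWord, *]) h (by simp [g, mul_assoc]) (by simp)⟩
    | 0, 2 =>
      exact ⟨key [b, a, b⁻¹, a⁻¹, b, a⁻¹] (by simp [IsWord, *]) h (by simp [g, mul_assoc])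
          (by simp),
        key [b, a, b⁻¹, a⁻¹, b] (by simp [IsWord, *]) h (by simp [g, mul_assoc])
          (by simp)⟩
    | 1, 0 =>
      exact ⟨key [a, b⁻¹] (by simp [IsWord, *]) h.2 (by simp [g, mul_assoc]) (by simp; omega),
        key [a] (by simp [IsWord, *]) h.2 (by simp [g, mul_assoc]) (by simp),
        key [] (by simp [IsWord]) h.2 (by simp [g, mul_assoc]) (by simp; omega)⟩
    | 1, 1 =>
      exact ⟨key [b, a⁻¹] (by simp [IsWord, *]) h.1 (by simp [g, mul_assoc]) (by simp),
        key [b] (by simp [IsWord, *]) h.1 (by simp [g, mul_assoc]) (by simp)⟩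
    | 1, 2 =>
      exact ⟨key [b, a, b⁻¹, a⁻¹, b, a⁻¹] (by simp [IsWord, *]) h.1 (by simp [g, mul_assoc])
          (by simp),
        key [b, a, b⁻¹, a⁻¹, b] (by simp [IsWord, *]) h.1 (by simp [g, mul_assoc])
          (by simp)⟩
    | 2, 0 =>
      exact ⟨key [a, a, b⁻¹] (by simp [IsWord, *]) h.1 (by simp [g, mul_assoc]) (by simp),
        key [a, a] (by simp [IsWord, *]) h.1 (by simp [g, mul_assoc]) (by simp),
        key [a] (by simp [IsWord, *]) h.1 (by simp [g, mul_assoc]) (by simp; omega)⟩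
    | 2, 1 =>
      exact key [] (by simp [IsWord]) h.2.2 (by simp [g]) (by simp)
    | 2, 2 =>
      exact ⟨key [a, b⁻¹, a⁻¹, b, a⁻¹] (by simp [IsWord, *]) h.2.1 (by simp [g, mul_assoc])
          (by simp; omega),
        key [a, b⁻¹, a⁻¹, b] (by simp [IsWord, *]) h.2.1 (by simp [g, mul_assoc])
          (by simp)⟩
  · intro s
    match s with
    | 0 => change (1 : ℝ) ≤ 6.35; norm_num
    | 1 => change (3.18 : ℝ) ≤ 6.35; norm_num
    | 2 => exact le_refl (6.35 : ℝ)
  · have e2 : z ^ (2 : ℤ) = 1 - 2 * z := by exact_mod_cast hz2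
    have em2 : z ^ (-2 : ℤ) = 5 + 2 * z := by
      rw [zpow_neg, ← inv_zpow, hinv, zpow_ofNat]; linear_combination hz2
    have e3 : z ^ (3 : ℤ) = 5 * z - 2 := by rw [zpow_ofNat]; linear_combination (z - 2) * hz2
    have e4 : z ^ (4 : ℤ) = 5 - 12 * z := by
      rw [zpow_ofNat]; linear_combination (z ^ 2 - 2 * z + 5) * hz2
    have e6 : z ^ (6 : ℤ) = 29 - 70 * z := by
      rw [zpow_ofNat]
      linear_combination (z ^ 4 - 2 * z ^ 3 + 5 * z ^ 2 - 12 * z + 29) * hz2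
    intro s
    match s with
    | 0 =>
      rw [Fin.sum_univ_three]
      change (1 : ℝ) ≤ z ^ (3 : ℤ) * 6.35 + z ^ (2 : ℤ) * 3.18 + z ^ (6 : ℤ) * 3.18
      rw [e2, e3, e6]; linarith
    | 1 =>
      rw [Fin.sum_univ_three]
      change (3.18 : ℝ) ≤ z ^ (1 : ℤ) * 6.35 + z ^ (2 : ℤ) * 3.18 + z ^ (6 : ℤ) * 3.18
      rw [e2, e6, zpow_one]; linarith
    | 2 =>
      rw [Fin.sum_univ_three]
      change (6.35 : ℝ) ≤ z ^ (3 : ℤ) * 6.35 + z ^ (-2 : ℤ) * 1 + z ^ (4 : ℤ) * 3.18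
      rw [em2, e3, e4]; linarith

/-- Now `ba⁻²` fixes the vertex, a rotation shorter than the commutator. Applied to `a` and to
`ba⁻¹`, it gives four branches with offsets `-1, 0, 1, 2`, distinct modulo `p ≥ 5`. -/
theorem growthRate_ge_of_eq_two_mul [Fact p.Prime] (hp : 5 ≤ p) (hfin : S.Finite)
    (hS : Subgroup.closure S = ⊤)
    (ha : a ∈ S ∨ a⁻¹ ∈ S) (hb : b ∈ S ∨ b⁻¹ ∈ S) (hm : 0 < m) (hn : n = m + m)
    (hDa : E.Descends u a m c) (hDb : E.Descends u b n d) (hcd : c ≠ d) :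
    1 / (√2 - 1) ≤ growthRate S := by
  subst hn
  obtain ⟨z, hz⟩ : ∃ z, z = √2 - 1 := ⟨_, rfl⟩
  obtain ⟨hz0, hz1, hz2, hinv⟩ := sqrt_two_sub_one_spec hz
  rw [← hz]
  have ha' : a⁻¹ ∈ S ∨ a ∈ S := ha.symm
  have hb' : b⁻¹ ∈ S ∨ b ∈ S := hb.symm
  have hy : E.Descends u (b * (a * a)⁻¹) 0 (d - c) := hDb.div_zero (hDa.mul hm hDa)
  have hw : E.Descends u (b * a⁻¹) (m + m - m) d := hDb.div hDa (by omega)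
  have hx := hy.zero_inv.zero_mul hDa
  have hw₂ := hy.zero_mul hw
  let g : Fin 4 → G := ![a, (b * (a * a)⁻¹)⁻¹ * a, b * a⁻¹, b * (a * a)⁻¹ * (b * a⁻¹)]
  let e : Fin 4 → ℤ := ![0, -1, 1, 2]
  have hfree : Function.Injective fun l : List (Fin 4) => (l.map g).prod := by
    refine injective_prod_of_descends (E := E) (u := u) (n := ![m, m, m + m - m, m + m - m])
      (c := fun i => c + e i * (d - c)) ?_ ?_
      (injective_add_intCast_mul (by decide) ?_ c (sub_ne_zero.2 hcd.symm))
    · intro i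
      fin_cases i <;> simp <;> omega
    · intro i
      match i with
      | 0 => exact hDa.congr (by simp [e])
      | 1 => exact hx.congr (by simp [e]; ring)
      | 2 => exact hw.congr (by simp [e])
      | 3 => exact hw₂.congr (by simp [e]; ring)
    · have : ∀ i j, |e i - e j| < 5 := by decide
      exact fun i j => (this i j).trans_le (by exact_mod_cast hp)
  -- State 1 remembers a final `a⁻¹`: a following `a` then has cost `-1`.
  refine growthRate_ge_of_automaton hfin hS g hfree (σ := Fin 2)
    ![![0, 0, 1, 1], ![0, 0, 1, 1]] ![![1, 4, 2, 5], ![-1, 2, 2, 5]]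
    (fun s k x => match s with
      | 0 => (wordLength S x : ℤ) ≤ k
      | 1 => (wordLength S x : ℤ) ≤ k ∧ (wordLength S (x * a) : ℤ) ≤ k - 1) ?_ ?_ 0
    (by exact_mod_cast wordLength_one_le S) (by linarith) (by linarith)
    ![1, 3.15] 3.15 (by simp) ?_ ?_
  · intro s k x h
    match s with
    | 0 => exact h
    | 1 => exact h.1
  · intro s k x i h
    have key := @wordLength_le_of_eq_mul G _ S hS
    have hw : ∀ k' : ℤ, (wordLength S x : ℤ) ≤ k' →
        (wordLength S (x * (b * a⁻¹)) : ℤ) ≤ k' + 2 ∧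
        (wordLength S (x * (b * a⁻¹) * a) : ℤ) ≤ k' + 2 - 1 := fun k' h =>
      ⟨key [b, a⁻¹] (by simp [IsWord, *]) h (by simp) (by simp),
        key [b] (by simp [IsWord, *]) h (by simp [mul_assoc]) (by simp)⟩
    have hw₂ : ∀ k' : ℤ, (wordLength S x : ℤ) ≤ k' →
        (wordLength S (x * (b * (a * a)⁻¹ * (b * a⁻¹))) : ℤ) ≤ k' + 5 ∧
        (wordLength S (x * (b * (a * a)⁻¹ * (b * a⁻¹)) * a) : ℤ) ≤ k' + 5 - 1 := fun k' h =>
      ⟨key [b, a⁻¹, a⁻¹, b, a⁻¹] (by simp [IsWord, *]) h (by simp [mul_assoc]) (by simp),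
        key [b, a⁻¹, a⁻¹, b] (by simp [IsWord, *]) h (by simp [mul_assoc]) (by simp)⟩
    match s, i with
    | 0, 0 => exact key [a] (by simp [IsWord, *]) h (by simp [g]) (by simp)
    | 0, 1 => exact key [a, a, b⁻¹, a] (by simp [IsWord, *]) h (by simp [g, mul_assoc]) (by simp)
    | 0, 2 => exact hw k h
    | 0, 3 => exact hw₂ k h
    | 1, 0 => exact h.2
    | 1, 1 =>
      exact key [a, b⁻¹, a] (by simp [IsWord, *]) h.2 (by simp [g, mul_assoc])
        (by simp; omega)
    | 1, 2 => exact hw k h.1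
    | 1, 3 => exact hw₂ k h.1
  · intro s
    match s with
    | 0 => change (1 : ℝ) ≤ 3.15; norm_num
    | 1 => exact le_refl (3.15 : ℝ)
  · have e2 : z ^ (2 : ℤ) = 1 - 2 * z := by exact_mod_cast hz2
    have em1 : z ^ (-1 : ℤ) = 2 + z := by rw [zpow_neg_one, hinv]
    have e4 : z ^ (4 : ℤ) = 5 - 12 * z := by
      rw [zpow_ofNat]; linear_combination (z ^ 2 - 2 * z + 5) * hz2
    have e5 : z ^ (5 : ℤ) = 29 * z - 12 := by
      rw [zpow_ofNat]; linear_combination (z ^ 3 - 2 * z ^ 2 + 5 * z - 12) * hz2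
    intro s
    match s with
    | 0 =>
      rw [Fin.sum_univ_four]
      change (1 : ℝ) ≤ z ^ (1 : ℤ) * 1 + z ^ (4 : ℤ) * 1 + z ^ (2 : ℤ) * 3.15 + z ^ (5 : ℤ) * 3.15
      rw [e2, e4, e5, zpow_one]; linarith
    | 1 =>
      rw [Fin.sum_univ_four]
      change (3.15 : ℝ) ≤
        z ^ (-1 : ℤ) * 1 + z ^ (2 : ℤ) * 1 + z ^ (2 : ℤ) * 3.15 + z ^ (5 : ℤ) * 3.15
      rw [e2, e5, em1]; linarith

/-- Now `ba⁻²` descends, and the commutator rotates both it and `a` to give four branches. -/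
theorem growthRate_ge_of_two_mul_lt [Fact p.Prime] (hp : 5 ≤ p) (hfin : S.Finite)
    (hS : Subgroup.closure S = ⊤)
    (ha : a ∈ S ∨ a⁻¹ ∈ S) (hb : b ∈ S ∨ b⁻¹ ∈ S) (hm : 0 < m) (hn : 2 * m < n)
    (hDa : E.Descends u a m c) (hDb : E.Descends u b n d) (hcd : c ≠ d) :
    1 / (√2 - 1) ≤ growthRate S := by
  obtain ⟨z, hz⟩ : ∃ z, z = √2 - 1 := ⟨_, rfl⟩
  obtain ⟨hz0, hz1, hz2, hinv⟩ := sqrt_two_sub_one_spec hz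
  rw [← hz]
  have ha' : a⁻¹ ∈ S ∨ a ∈ S := ha.symm
  have hb' : b⁻¹ ∈ S ∨ b ∈ S := hb.symm
  have hy := descends_commutator hm (by omega) hDa hDb
  have hw : E.Descends u (b * (a * a)⁻¹) (n - (m + m)) d := hDb.div (hDa.mul hm hDa) (by omega)
  have hx := hy.zero_inv.zero_mul hDa
  have hw₂ := hy.zero_mul hw
  let g : Fin 4 → G := ![a, (b * a * b⁻¹ * a⁻¹)⁻¹ * a, b * (a * a)⁻¹,
    b * a * b⁻¹ * a⁻¹ * (b * (a * a)⁻¹)]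
  let e : Fin 4 → ℤ := ![0, -1, 1, 2]
  have hfree : Function.Injective fun l : List (Fin 4) => (l.map g).prod := by
    refine injective_prod_of_descends (E := E) (u := u)
      (n := ![m, m, n - (m + m), n - (m + m)])
      (c := fun i => c + e i * (d - c)) ?_ ?_
      (injective_add_intCast_mul (by decide) ?_ c (sub_ne_zero.2 hcd.symm))
    · intro i
      fin_cases i <;> simp <;> omega
    · intro i
      match i with
      | 0 => exact hDa.congr (by simp [e])
      | 1 => exact hx.congr (by simp [e]; ring)
      | 2 => exact hw.congr (by simp [e])
      | 3 => exact hw₂.congr (by simp [e]; ring)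
    · have : ∀ i j, |e i - e j| < 5 := by decide
      exact fun i j => (this i j).trans_le (by exact_mod_cast hp)
  -- State 1 remembers a final `a⁻²` and state 2 a final `a⁻¹`, so up to two letters `a` in
  -- succession shorten the word.
  refine growthRate_ge_of_automaton hfin hS g hfree (σ := Fin 3)
    ![![0, 0, 1, 1], ![2, 0, 1, 1], ![0, 0, 1, 1]]
    ![![1, 5, 3, 7], ![-1, 3, 3, 7], ![-1, 3, 3, 7]]
    (fun s k x => match s with
      | 0 => (wordLength S x : ℤ) ≤ k
      | 1 => (wordLength S x : ℤ) ≤ k ∧ (wordLength S (x * a) : ℤ) ≤ k - 1 ∧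
          (wordLength S (x * a * a) : ℤ) ≤ k - 2
      | 2 => (wordLength S x : ℤ) ≤ k ∧ (wordLength S (x * a) : ℤ) ≤ k - 1) ?_ ?_ 0
    (by exact_mod_cast wordLength_one_le S) (by linarith) (by linarith)
    ![1, 8, 3.06] 8 (by simp) ?_ ?_
  · intro s k x h
    match s with
    | 0 => exact h
    | 1 => exact h.1
    | 2 => exact h.1
  · intro s k x i h
    have key := @wordLength_le_of_eq_mul G _ S hS
    have hw : ∀ k' : ℤ, (wordLength S x : ℤ) ≤ k' →
        (wordLength S (x * (b * (a * a)⁻¹)) : ℤ) ≤ k' + 3 ∧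
        (wordLength S (x * (b * (a * a)⁻¹) * a) : ℤ) ≤ k' + 3 - 1 ∧
        (wordLength S (x * (b * (a * a)⁻¹) * a * a) : ℤ) ≤ k' + 3 - 2 := fun k' h =>
      ⟨key [b, a⁻¹, a⁻¹] (by simp [IsWord, *]) h (by simp) (by simp),
        key [b, a⁻¹] (by simp [IsWord, *]) h (by simp [mul_assoc]) (by simp),
        key [b] (by simp [IsWord, *]) h (by simp [mul_assoc]) (by simp; omega)⟩
    have hw₂ : ∀ k' : ℤ, (wordLength S x : ℤ) ≤ k' →
        (wordLength S (x * (b * a * b⁻¹ * a⁻¹ * (b * (a * a)⁻¹))) : ℤ) ≤ k' + 7 ∧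
        (wordLength S (x * (b * a * b⁻¹ * a⁻¹ * (b * (a * a)⁻¹)) * a) : ℤ) ≤ k' + 7 - 1 ∧
        (wordLength S (x * (b * a * b⁻¹ * a⁻¹ * (b * (a * a)⁻¹)) * a * a) : ℤ) ≤ k' + 7 - 2 :=
      fun k' h =>
      ⟨key [b, a, b⁻¹, a⁻¹, b, a⁻¹, a⁻¹] (by simp [IsWord, *]) h (by simp [mul_assoc]) (by simp),
        key [b, a, b⁻¹, a⁻¹, b, a⁻¹] (by simp [IsWord, *]) h (by simp [mul_assoc])
          (by simp),
        key [b, a, b⁻¹, a⁻¹, b] (by simp [IsWord, *]) h (by simp [mul_assoc])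
          (by simp; omega)⟩
    have hx : ∀ k' : ℤ, (wordLength S (x * a) : ℤ) ≤ k' - 1 →
        (wordLength S (x * ((b * a * b⁻¹ * a⁻¹)⁻¹ * a)) : ℤ) ≤ k' + 3 := fun k' h =>
      key [b, a⁻¹, b⁻¹, a] (by simp [IsWord, *]) h (by simp [mul_assoc]) (by simp; omega)
    match s, i with
    | 0, 0 => exact key [a] (by simp [IsWord, *]) h (by simp [g]) (by simp)
    | 0, 1 =>
      exact key [a, b, a⁻¹, b⁻¹, a] (by simp [IsWord, *]) h (by simp [g, mul_assoc]) (by simp)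
    | 0, 2 => exact hw k h
    | 0, 3 => exact hw₂ k h
    | 1, 0 => exact ⟨h.2.1, h.2.2.trans (by simp; omega)⟩
    | 1, 1 => exact hx k h.2.1
    | 1, 2 => exact hw k h.1
    | 1, 3 => exact hw₂ k h.1
    | 2, 0 => exact h.2
    | 2, 1 => exact hx k h.2
    | 2, 2 => exact hw k h.1
    | 2, 3 => exact hw₂ k h.1
  · intro s
    match s with
    | 0 => change (1 : ℝ) ≤ 8; norm_num
    | 1 => exact le_refl (8 : ℝ)
    | 2 => change (3.06 : ℝ) ≤ 8; norm_num
  · have em1 : z ^ (-1 : ℤ) = 2 + z := by rw [zpow_neg_one, hinv]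
    have e3 : z ^ (3 : ℤ) = 5 * z - 2 := by rw [zpow_ofNat]; linear_combination (z - 2) * hz2
    have e5 : z ^ (5 : ℤ) = 29 * z - 12 := by
      rw [zpow_ofNat]; linear_combination (z ^ 3 - 2 * z ^ 2 + 5 * z - 12) * hz2
    have e7 : z ^ (7 : ℤ) = 169 * z - 70 := by
      rw [zpow_ofNat]
      linear_combination (z ^ 5 - 2 * z ^ 4 + 5 * z ^ 3 - 12 * z ^ 2 + 29 * z - 70) * hz2
    intro s
    match s with
    | 0 =>
      rw [Fin.sum_univ_four]
      change (1 : ℝ) ≤ z ^ (1 : ℤ) * 1 + z ^ (5 : ℤ) * 1 + z ^ (3 : ℤ) * 8 + z ^ (7 : ℤ) * 8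
      rw [e3, e5, e7, zpow_one]; linarith
    | 1 =>
      rw [Fin.sum_univ_four]
      change (8 : ℝ) ≤ z ^ (-1 : ℤ) * 3.06 + z ^ (3 : ℤ) * 1 + z ^ (3 : ℤ) * 8 + z ^ (7 : ℤ) * 8
      rw [e3, e7, em1]; linarith
    | 2 =>
      rw [Fin.sum_univ_four]
      change (3.06 : ℝ) ≤ z ^ (-1 : ℤ) * 1 + z ^ (3 : ℤ) * 1 + z ^ (3 : ℤ) * 8 + z ^ (7 : ℤ) * 8
      rw [e3, e7, em1]; linarith

end AscendingHNN

/-! ### Estimates for `ω_k` -/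

theorem wordLength_pow_mul_le {G : Type*} [Group G] {S : Set G} (hS : Subgroup.closure S = ⊤)
    (g x : G) (i : ℕ) : wordLength S (g ^ i * x) ≤ i * wordLength S g + wordLength S x := by
  induction i with
  | zero => simp
  | succ i ih =>
    rw [pow_succ', mul_assoc, Nat.succ_mul]
    have := wordLength_mul_le hS g (g ^ i * x)
    omega

/-- The defining equation of `ω_k`, in terms of its inverse. -/
theorem inv_omegaRoot_spec {k : ℕ} (hk : 0 < k) :
    0 < (omegaRoot k)⁻¹ ∧ (omegaRoot k)⁻¹ < 1 ∧
      (omegaRoot k)⁻¹ + ∑ i ∈ Finset.range k, 2 * (omegaRoot k)⁻¹ ^ (i + 2) = 1 := by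
  obtain ⟨hx, hroot⟩ : 0 < omegaRoot k ∧ (rootPoly k).IsRoot (omegaRoot k) :=
    (existsUnique_pos_root k).choose_spec.1
  generalize omegaRoot k = x at hx hroot
  rw [Polynomial.IsRoot, eval_rootPoly] at hroot
  have hx1 : 1 < x := by
    have hpos : 0 < ∑ i ∈ Finset.range k, 2 * x ^ i :=
      Finset.sum_pos (fun i _ => by positivity) ⟨0, Finset.mem_range.2 hk⟩
    have hxk : 0 < x ^ k := by positivity
    rw [pow_succ] at hroot
    by_contra! hle
    nlinarith
  refine ⟨inv_pos.2 hx, inv_lt_one_of_one_lt₀ hx1, ?_⟩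
  have h : x⁻¹ + ∑ i ∈ Finset.range k, x⁻¹ ^ (k + 1) * (2 * x ^ i) = 1 := by
    rw [← Finset.mul_sum]
    have e : x⁻¹ ^ (k + 1) * x ^ (k + 1) = 1 := by
      rw [← mul_pow, inv_mul_cancel₀ hx.ne', one_pow]
    have e' : x⁻¹ ^ (k + 1) * x ^ k = x⁻¹ := by
      rw [pow_succ', mul_assoc, ← mul_pow, inv_mul_cancel₀ hx.ne', one_pow, mul_one]
    linear_combination -x⁻¹ ^ (k + 1) * hroot - e' + e
  rw [← h, ← Finset.sum_range_reflect]
  congr 1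
  refine Finset.sum_congr rfl fun i hi => ?_
  have hi' := Finset.mem_range.1 hi
  rw [show k + 1 = (k - 1 - i + 2) + i by omega, pow_add]
  have e : x⁻¹ ^ i * x ^ i = 1 := by rw [← mul_pow, inv_mul_cancel₀ hx.ne', one_pow]
  linear_combination -2 * x⁻¹ ^ (k - 1 - i + 2) * e

/-- Multiplying by `z - 1` sums the geometric series. The result compares `z` with `√2 - 1`, the
positive root of `z² + 2z - 1`. -/
theorem two_mul_add_sq_of_sum_eq_one {k : ℕ} {z : ℝ}
    (h : z + ∑ i ∈ Finset.range k, 2 * z ^ (i + 2) = 1) :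
    2 * z + z ^ 2 - 1 = 2 * z ^ (k + 2) := by
  have hg := geom_sum_mul z k
  have e : ∑ i ∈ Finset.range k, 2 * z ^ (i + 2) = 2 * z ^ 2 * ∑ i ∈ Finset.range k, z ^ i := by
    rw [Finset.mul_sum]
    exact Finset.sum_congr rfl fun i _ => by ring
  rw [e] at h
  rw [pow_add]
  linear_combination 2 * z ^ 2 * hg - (z - 1) * h

theorem omegaRoot_le {k : ℕ} (hk : 0 < k) : omegaRoot k ≤ 1 / (√2 - 1) := by
  obtain ⟨h0, h1, hsum⟩ := inv_omegaRoot_spec hk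
  have h := two_mul_add_sq_of_sum_eq_one hsum
  have hpos : 0 < 2 * (omegaRoot k)⁻¹ ^ (k + 2) := by positivity
  have h2 : √2 ^ 2 = 2 := Real.sq_sqrt (by norm_num)
  have hs : 1 < √2 := Real.lt_sqrt_of_sq_lt (by norm_num)
  rw [← inv_inv (omegaRoot k), ← one_div, one_div_le_one_div h0 (by linarith)]
  nlinarith

theorem omegaRoot_one_le : omegaRoot 1 ≤ 2 := by
  obtain ⟨h0, h1, hsum⟩ := inv_omegaRoot_spec one_pos
  rw [Finset.sum_range_one] at hsum
  rw [← inv_inv (omegaRoot 1)]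
  have : (2 : ℝ)⁻¹ ≤ (omegaRoot 1)⁻¹ := by nlinarith
  exact inv_le_of_inv_le₀ (by norm_num) this

/-! ### Rotations and conclusion -/

namespace AscendingHNN

variable {H G : Type*} [Group H] [Group G] {p : ℕ} {E : AscendingHNN H G p} {S : Set G}
  {u a b y : G} {m n k : ℕ} {c d δ : ZMod p} {z : ℝ}

/-- The free monoid generated by the elements `y ^ i * a` for `|i| ≤ k`, where `y` rotates the
branches at a vertex of the axis of `a`. -/
theorem growthRate_ge_of_rotation [Fact p.Prime] (hp : p = 2 * k + 1) (hfin : S.Finite)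
    (hS : Subgroup.closure S = ⊤) (hm : 0 < m) (hDa : E.Descends u a m c)
    (hDy : E.Descends u y 0 δ) (hδ : δ ≠ 0) (hz : 0 < z) (hz1 : z ≤ 1) (ℓ ℓ' : ℕ → ℕ)
    (ha : wordLength S a ≤ 1) (hℓ : ∀ i, wordLength S (y ^ (i + 1) * a) ≤ ℓ i)
    (hℓ' : ∀ i, wordLength S (y⁻¹ ^ (i + 1) * a) ≤ ℓ' i)
    (hsum : 1 ≤ z + ∑ i ∈ Finset.range k, (z ^ ℓ i + z ^ ℓ' i)) : 1 / z ≤ growthRate S := by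
  let g : Option (Fin k ⊕ Fin k) → G
    | none => a
    | some (.inl i) => y ^ (i.val + 1) * a
    | some (.inr i) => y⁻¹ ^ (i.val + 1) * a
  let e : Option (Fin k ⊕ Fin k) → ℤ
    | none => 0
    | some (.inl i) => i.val + 1
    | some (.inr i) => -(i.val + 1)
  have hfree : Function.Injective fun l : List (Option (Fin k ⊕ Fin k)) => (l.map g).prod := by
    refine injective_prod_of_descends (E := E) (u := u) (n := fun _ => m)
      (c := fun i => c + e i * δ) (fun _ => hm) ?_ (injective_add_intCast_mul ?_ ?_ c hδ)
    · rintro (_ | i | i)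
      · exact hDa.congr (by simp [e])
      · exact ((hDy.zero_pow (i + 1)).zero_mul hDa).congr (by simp [e]; ring)
      · exact ((hDy.zero_inv.zero_pow (i + 1)).zero_mul hDa).congr (by simp [e]; ring)
    · rintro (_ | i | i) (_ | j | j) h <;> simp only [e] at h <;> first
        | rfl
        | omega
        | (congr 2; ext; omega)
    · have hb : ∀ i, |e i| ≤ k := by
        rintro (_ | i | i) <;> simp only [e, abs_le] <;> omega
      intro i j
      have := abs_sub (e i) (e j)
      have := hb i
      have := hb j
      omega
  refine growthRate_ge_of_code hfin hS g hfree
    (fun | none => 1 | some (.inl i) => ℓ i | some (.inr i) => ℓ' i) ?_ hz hz1 ?_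
  · rintro (_ | i | i)
    exacts [ha, hℓ i, hℓ' i]
  · rw [Finset.sum_add_distrib, Finset.sum_range, Finset.sum_range] at hsum
    simpa [Fintype.sum_option, Fintype.sum_sum_type] using hsum

theorem omegaRoot_le_of_elliptic [Fact p.Prime] (hp : p = 2 * k + 1) (hk : 0 < k)
    (hfin : S.Finite) (hS : Subgroup.closure S = ⊤) (ha : a ∈ S ∨ a⁻¹ ∈ S)
    (hy : y ∈ S ∨ y⁻¹ ∈ S) (hm : 0 < m) (hDa : E.Descends u a m c)
    (hDy : E.Descends u y 0 δ) (hδ : δ ≠ 0) : omegaRoot k ≤ growthRate S := by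
  obtain ⟨h0, h1, hsum⟩ := inv_omegaRoot_spec hk
  have hla := wordLength_le_one ha
  have hly := wordLength_le_one hy
  have hly' : wordLength S y⁻¹ ≤ 1 := wordLength_le_one (by simpa using hy.symm)
  have key : ∀ g : G, wordLength S g ≤ 1 → ∀ i, wordLength S (g ^ (i + 1) * a) ≤ i + 2 := by
    intro g hg i
    have h1 := wordLength_pow_mul_le hS g a (i + 1)
    have h2 := Nat.mul_le_mul_left (i + 1) hg
    omega
  have := growthRate_ge_of_rotation hp hfin hS hm hDa hDy hδ h0 h1.le (fun i => i + 2)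
    (fun i => i + 2) hla (key y hly) (key y⁻¹ hly') (by simpa only [← two_mul] using hsum.ge)
  simpa using this

/-- The rotation `y = ba⁻¹` has length at most 2, but `y ^ (i + 1) * a = y ^ i * b` saves two
letters. The resulting lengths `2i + 1` and `2i + 3` are good enough at `1 / ω_k`. -/
theorem omegaRoot_le_of_same_translation [Fact p.Prime] (hp : p = 2 * k + 1) (hk : 0 < k)
    (hfin : S.Finite) (hS : Subgroup.closure S = ⊤) (ha : a ∈ S ∨ a⁻¹ ∈ S)
    (hb : b ∈ S ∨ b⁻¹ ∈ S) (hm : 0 < m) (hDa : E.Descends u a m c)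
    (hDb : E.Descends u b m d) (hcd : c ≠ d) : omegaRoot k ≤ growthRate S := by
  obtain ⟨h0, h1, hsum⟩ := inv_omegaRoot_spec hk
  have hla := wordLength_le_one ha
  have hlb := wordLength_le_one hb
  have hla' : wordLength S a⁻¹ ≤ 1 := wordLength_le_one (by simpa using ha.symm)
  have hlb' : wordLength S b⁻¹ ≤ 1 := wordLength_le_one (by simpa using hb.symm)
  have hy : wordLength S (b * a⁻¹) ≤ 2 := (wordLength_mul_le hS _ _).trans (by omega)
  have hy' : wordLength S (b * a⁻¹)⁻¹ ≤ 2 := by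
    rw [mul_inv_rev, inv_inv]
    exact (wordLength_mul_le hS _ _).trans (by omega)
  have := growthRate_ge_of_rotation hp hfin hS hm hDa (hDb.div_zero hDa)
    (sub_ne_zero.2 hcd.symm) h0 h1.le (fun i => 2 * i + 1) (fun i => 2 * i + 3) hla
    (fun i => by
      rw [pow_succ, mul_assoc, inv_mul_cancel_right]
      have h1 := wordLength_pow_mul_le hS (b * a⁻¹) b i
      have h2 := Nat.mul_le_mul_left i hy
      omega)
    (fun i => by
      have h1 := wordLength_pow_mul_le hS (b * a⁻¹)⁻¹ a (i + 1)
      have h2 := Nat.mul_le_mul_left (i + 1) hy'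
      omega) ?_
  · simpa using this
  generalize (omegaRoot k)⁻¹ = z at h0 h1 hsum
  have hz := two_mul_add_sq_of_sum_eq_one hsum
  have hgeom : ∀ j : ℕ,
      (1 - z ^ 2) * (z + ∑ i ∈ Finset.range j, (z ^ (2 * i + 1) + z ^ (2 * i + 3)))
      = 2 * z - z ^ (2 * j + 1) - z ^ (2 * j + 3) := by
    intro j
    induction j with
    | zero => simp; ring
    | succ j ih =>
      rw [Finset.sum_range_succ, ← add_assoc, mul_add, ih]
      ring
  -- After multiplication by `1 - z²`, the claim is `z^(2k+1) + z^(2k+3) ≤ 2z^(k+2)`, true since `k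
  -- ≥ 1` and `z < 1`.
  have hle1 : z ^ (2 * k + 1) ≤ z ^ (k + 2) := pow_le_pow_of_le_one h0.le h1.le (by omega)
  have hle2 : z ^ (2 * k + 3) ≤ z ^ (k + 2) := pow_le_pow_of_le_one h0.le h1.le (by omega)
  have hpos : 0 < 1 - z ^ 2 := by nlinarith
  refine le_of_mul_le_mul_left ?_ hpos
  rw [hgeom k]
  linarith

theorem growthRate_ge_of_lt [Fact p.Prime] (hp : 5 ≤ p) (hfin : S.Finite)
    (hS : Subgroup.closure S = ⊤)
    (ha : a ∈ S ∨ a⁻¹ ∈ S) (hb : b ∈ S ∨ b⁻¹ ∈ S) (hm : 0 < m) (hmn : m < n)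
    (hDa : E.Descends u a m c) (hDb : E.Descends u b n d) (hcd : c ≠ d) :
    1 / (√2 - 1) ≤ growthRate S := by
  rcases lt_trichotomy n (2 * m) with h | h | h
  · exact growthRate_ge_of_lt_two_mul hp hfin hS ha hb hm hmn h hDa hDb hcd
  · exact growthRate_ge_of_eq_two_mul hp hfin hS ha hb hm (by omega) hDa hDb hcd
  · exact growthRate_ge_of_two_mul_lt hp hfin hS ha hb hm h hDa hDb hcd

theorem omegaRoot_le_growthRate (E : AscendingHNN H G p) (hpr : p.Prime) (hp : p = 2 * k + 1)
    (hfin : S.Finite) (hS : Subgroup.closure S = ⊤) : omegaRoot k ≤ growthRate S := by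
  have : Fact p.Prime := ⟨hpr⟩
  have hk : 0 < k := by have := hpr.two_le; omega
  obtain ⟨u, a, b, m, n, c, d, ha, hb, hm, hDa, hDb, ⟨rfl, hd⟩ | ⟨hn, hcd⟩⟩ :=
    E.exists_diverging_pair hfin hS
  · exact omegaRoot_le_of_elliptic hp hk hfin hS ha hb hm hDa hDb hd
  · rcases Nat.eq_or_lt_of_le hk with h1 | h1
    -- For `p = 3` there are too few branches for the four-letter codes, but the free monoid on `a`
    -- and `b` already reaches `ω_1 = 2`.
    · subst h1
      exact omegaRoot_one_le.trans (two_le_growthRate hfin hS ha hb hm hn hDa hDb hcd)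
    · have hp5 : 5 ≤ p := by omega
      rcases lt_trichotomy m n with h | rfl | h
      · exact (omegaRoot_le hk).trans (growthRate_ge_of_lt hp5 hfin hS ha hb hm h hDa hDb hcd)
      · exact omegaRoot_le_of_same_translation hp hk hfin hS ha hb hm hDa hDb hcd
      · exact (omegaRoot_le hk).trans
          (growthRate_ge_of_lt hp5 hfin hS hb ha hn h hDb hDa hcd.symm)

theorem goldenRatio_le_growthRate (E : AscendingHNN H G p) (hfin : S.Finite)
    (hS : Subgroup.closure S = ⊤) :
    (1 + √5) / 2 ≤ growthRate S := by
  have h5 : √5 ^ 2 = 5 := Real.sq_sqrt (by norm_num)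
  have h5' : √5 < 3 := (Real.sqrt_lt' (by norm_num)).2 (by norm_num)
  have h5'' : 2 < √5 := Real.lt_sqrt_of_sq_lt (by norm_num)
  obtain ⟨u, a, b, m, n, c, d, ha, hb, hm, hDa, hDb, ⟨rfl, hd⟩ | ⟨hn, hcd⟩⟩ :=
    E.exists_diverging_pair hfin hS
  · have hlen : wordLength S (b * a) ≤ 2 := (wordLength_mul_le hS b a).trans
      (add_le_add (wordLength_le_one hb) (wordLength_le_one ha))
    have := growthRate_ge_of_code hfin hS ![a, b * a]
      (injective_prod_of_descends (E := E) (u := u) (n := ![m, m]) (c := ![c, d + c])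
        (by simp [hm]) (by simp [hDa, hDb.zero_mul hDa])
        (by intro i j; fin_cases i <;> fin_cases j <;> simp [hd]))
      ![1, 2] (by simp [wordLength_le_one ha, hlen])
      (z := (√5 - 1) / 2) (by linarith) (by linarith) (by simp; nlinarith)
    refine le_trans ?_ this
    rw [le_div_iff₀ (by linarith)]
    nlinarith
  · exact le_trans (by linarith) (two_le_growthRate hfin hS ha hb hm hn hDa hDb hcd)

end AscendingHNN

theorem le_minGrowthRate {G : Type*} [Group G] [Group.FG G] {r : ℝ}
    (h : ∀ S : Set G, S.Finite → Subgroup.closure S = ⊤ → r ≤ growthRate S) :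
    r ≤ minGrowthRate G := by
  -- The infimum must run over a nonempty set, as `sInf ∅ = 0` in `ℝ`.
  obtain ⟨S, hS, hfin⟩ := Group.fg_iff.1 (inferInstance : Group.FG G)
  refine le_csInf ⟨_, S, hfin, hS, rfl⟩ ?_
  rintro _ ⟨S, hfin, hS, rfl⟩
  exact h S hfin hS

end GroupGrowth

theorem theorem2 {H : Type*} [Group H] (B : Subgroup H) [B.Normal]
    (θ : (⊤ : Subgroup H) ≃* B) (p : ℕ) (hp : p.Prime) (hB : B.index = p)
    [Group.FG (HNNExtension H ⊤ B θ)] :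
    (p = 2 →
      (1 + Real.sqrt 5) / 2 ≤ GroupGrowth.minGrowthRate (HNNExtension H ⊤ B θ)) ∧
    (∀ k : ℕ, p = 2 * k + 1 →
      GroupGrowth.omegaRoot k ≤ GroupGrowth.minGrowthRate (HNNExtension H ⊤ B θ)) := by
  obtain ⟨E⟩ := GroupGrowth.nonempty_ascendingHNN B θ hp hB
  exact ⟨fun _ => GroupGrowth.le_minGrowthRate fun _ hfin hS => E.goldenRatio_le_growthRate hfin hS,
    fun k hk => GroupGrowth.le_minGrowthRate fun _ hfin hS =>
      E.omegaRoot_le_growthRate hp hk hfin hS⟩
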